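/- Let $S^1=\mathbb R/2\pi\mathbb Z$ and let $R:S^1\to\mathbb R$ be smooth, with finitely many stationary points, at each of which some derivative of $R$ of positive order is nonzero. Let $\mathcal H_{\rm aux}=L^2(S^1\times S^1,dx\,dy)$, and let $\Phi\subset\mathcal H_{\rm aux}$ be the space of finite sums $f(x,y)=\sum_{m\in\mathbb Z}e^{imx}f_m(y)$ with $f_m\in C^\infty(S^1,\mathbb C)$. On $\Phi$ put $\hat C=-\partial_x^2-R(y)$ and $U(t)=e^{-it\hat C}$, i.e. $(U(t)f)(x,y)=\sum_m e^{-it(m^2-R(y))}e^{imx}f_m(y)$. Let $\mathcal A_{\rm obs}$ consist of the linear operators $\mathcal O$ on $\mathcal H_{\rm aux}$ such that the domains of $\mathcal O$ and $\mathcal O^\dagger$ contain $\Phi$, both operators map $\Phi$ to itself, and $\mathcal O$ commutes with $U(t)$ on $\Phi$ for all $t\in\mathbb R$. Let $\Phi^*$ be the algebraic dual of $\Phi$, with the dual actions $(\mathcal Ou)[\phi]=u[\mathcal O^\dagger\phi]$ and $(U(t)u)[\phi]=u[U(-t)\phi]$. An antilinear map $\eta:\Phi\to\Phi^*$ is called a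 *rigging map* if it is real ($\overline{\eta(\phi_1)[\phi_2]}=\eta(\phi_2)[\phi_1]$), positive ($\eta(\phi)[\phi]\ge0$), invariant ($U(t)\,\eta(\phi)=\eta(\phi)$ for all $t$), and intertwines with $\mathcal A_{\rm obs}$ ($\eta(\mathcal O\phi)=\mathcal O(\eta\phi)$ for all $\mathcal O\in\mathcal A_{\rm obs}$, $\phi\in\Phi$). Its image then carries the inner product $(\eta(\phi_1),\eta(\phi_2))_{\rm RAQ}=\eta(\phi_2)[\phi_1]$. Consider the equation $q^2=R(y)$ with $q\in\{0,1,2,\dots\}$ and assume that it has a solution for some $q$; it has only finitely many solutions in all. For a finite set $S$ of pairs $(m,y_0)\in\mathbb Z\times S^1$ and $c:S\to\mathbb C$ let $\eta_{S,c}(f)=2\pi\sum_{(m,y_0)\in S}c(m,y_0)\,\overline{f_m(y_0)}\,e^{-imx}\delta(y,y_0)$, so that $\eta_{S,c}(f)[g]=(2\pi)^2\sum_{(m,y_0)\in S}c(m,y_0)\overline{f_m(y_0)}\,g_m(y_0)$. For a solution $y_0$ let $p\ge1$ be the order of the lowest nonvanishing derivative of $R$ at $y_0$, and let $\mathcal P$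 be the set of all values of $p$ that occur. For odd $p\in\mathcal P$ let $S_p$ be the set of all pairs $(m,y_0)$ with $m\in\mathbb Z$, $m^2=R(y_0)$ and $y_0$ of order $p$. For even $p\in\mathcal P$ and $\epsilon\in\{1,-1\}$ let $S_{p\epsilon}$ be the set of those pairs for which, in addition, $R^{(p)}(y_0)$ has sign $\epsilon$. For each odd $p\in\mathcal P$, and for each even $p\in\mathcal P$ and $\epsilon$ with $S_{p\epsilon}\neq\emptyset$, let $\eta_p$, respectively $\eta_{p\epsilon}$, be the map $\eta_{S,c}$ with $S=S_p$, respectively $S=S_{p\epsilon}$, and $c(m,y_0)=|R^{(p)}(y_0)|^{-1/p}$. (1) *Generic case.* Suppose that no solution of $q^2=R(y)$ is a stationary point of $R$. Let $\eta=\eta_{S,c}$ with $S=\{(m,y_0):m^2=R(y_0)\}$ and $c(m,y_0)=|R'(y_0)|^{-1}$. Then $\mathcal P=\{1\}$, and the only map of the above family is $\eta_1=\eta$. The map $\eta$ is a rigging map; its image is finite-dimensional and nonzero, and the RAQ inner product is positive definite on it. For $c:S\to\mathbb C$, the map $\eta_{S,c}$ intertwines with $\mathcal A_{\rm obs}$ if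 and only if there is a constant $\lambda\in\mathbb C$ with $c(m,y_0)=\lambda\,|R'(y_0)|^{-1}$ on $S$. (2) *Stationary points among the solutions allowed.* Suppose that, whenever $p\in\mathcal P$, the set $\mathcal P$ contains no factor of $p$ smaller than $p/2$. Then: (a) Each $\eta_p$ and each $\eta_{p\epsilon}$ is a rigging map; its image is finite-dimensional and nonzero, and the RAQ inner product is positive definite on it. (b) The coefficients are fixed, up to an overall constant, by the intertwining requirement: for $S=S_p$ (or $S=S_{p\epsilon}$, nonempty) and $c:S\to\mathbb C$, the map $\eta_{S,c}$ intertwines with $\mathcal A_{\rm obs}$ if and only if there is $\lambda\in\mathbb C$ with $c(m,y_0)=\lambda\,|R^{(p)}(y_0)|^{-1/p}$ on $S$. (c) The images of any two distinct maps meet only in zero, and the sum of all the images in $\Phi^*$ is direct. (d) The images are superselection sectors. The sum $\eta_{\rm tot}$ of all the maps $\eta_p$, $\eta_{p\epsilon}$ is a rigging map whose image is the direct sum of their images, with positive definite RAQ inner product. This inner product restricts on each image to that image's own RAQ inner product. Each image is invariant under $\mathcal A_{\rm obs}$, and distinct images are orthogonal, so that $(u,\mathcal Ov)_{\rm RAQ}=0$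 for all $\mathcal O\in\mathcal A_{\rm obs}$ and all $u$, $v$ in distinct images. -/

import Mathlib

open scoped ContDiff InnerProductSpace ComplexConjugate
open MeasureTheory

noncomputable section

namespace Boulware

/-! ### The circle, smooth functions on it, and the auxiliary Hilbert space -/

instance instTwoPiPos : Fact (0 < 2 * Real.pi) := Fact.mk Real.two_pi_pos

/-- The circle `S¹ = ℝ / 2πℤ`, with its arc-length measure of total mass `2π`. -/
abbrev S1 : Type := AddCircle (2 * Real.pi)

/-- A function on the circle is smooth iff its `2π`-periodic lift to `ℝ` is `C^∞`. -/
def IsSmooth {E : Type*} [NormedAddCommGroup E] [NormedSpace ℝ E] (f : S1 → E) : Prop :=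
  ContDiff ℝ ∞ (fun s : ℝ => f (s : S1))

theorem IsSmooth.continuous {E : Type*} [NormedAddCommGroup E] [NormedSpace ℝ E] {f : S1 → E}
    (hf : IsSmooth f) : Continuous f :=
  continuous_coinduced_dom.2 (ContDiff.continuous (𝕜 := ℝ) hf)

theorem periodic_iteratedDeriv (k : ℕ) (R : S1 → ℝ) :
    Function.Periodic (iteratedDeriv k (fun s : ℝ => R (s : S1))) (2 * Real.pi) := by
  intro s
  have h := iteratedDeriv_comp_add_const k (fun s : ℝ => R (s : S1)) (2 * Real.pi)
  have h2 : (fun z : ℝ => R ((z + 2 * Real.pi : ℝ) : S1)) = fun z : ℝ => R (z : S1) := by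
    funext z
    rw [AddCircle.coe_add_period]
  rw [h2] at h
  exact (congrFun h s).symm

/-- The `k`-th derivative `R^{(k)}` of a function `R` on the circle, again as a function on the
circle. -/
def circleDeriv (k : ℕ) (R : S1 → ℝ) : S1 → ℝ :=
  (periodic_iteratedDeriv k R).lift

theorem circleDeriv_coe (k : ℕ) (R : S1 → ℝ) (s : ℝ) :
    circleDeriv k R (s : S1) = iteratedDeriv k (fun s : ℝ => R (s : S1)) s := rfl

/-- `C^∞(S¹, ℂ)`. -/
def SmoothFn : Submodule ℂ (S1 → ℂ) where
  carrier := {f | IsSmooth f}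
  add_mem' {f g} hf hg := by
    have hf' : ContDiff ℝ ∞ (fun s : ℝ => f (s : S1)) := hf
    have hg' : ContDiff ℝ ∞ (fun s : ℝ => g (s : S1)) := hg
    exact hf'.add hg'
  zero_mem' := by
    change ContDiff ℝ ∞ (fun _ : ℝ => (0 : ℂ))
    exact contDiff_const
  smul_mem' c f hf := by
    have hf' : ContDiff ℝ ∞ (fun s : ℝ => f (s : S1)) := hf
    exact hf'.const_smul c

/-- The torus `𝒞 = S¹ × S¹`, with points `(x, y)`. -/
abbrev Torus : Type := S1 × S1

/-- The auxiliary Hilbert space `L²(𝒞)` for `∫ dx dy`. Mathlib's inner product is conjugate-linear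
in the first argument. -/
abbrev Haux : Type := Lp ℂ 2 (volume : Measure Torus)

/-- The test space `Φ`. An element `f` is the finitely supported family of its Fourier components
`f_m ∈ C^∞(S¹, ℂ)`; it stands for the function `f(x,y) = ∑_m e^{imx} f_m(y)`, see `toFun`. -/
abbrev TestSpace : Type := ℤ →₀ SmoothFn

/-- The function `(x,y) ↦ e^{imx} g(y)`. -/
def modeMap (m : ℤ) : SmoothFn →ₗ[ℂ] C(Torus, ℂ) where
  toFun g := ⟨fun z => fourier m z.1 * (g : S1 → ℂ) z.2,
    ((fourier m).continuous.comp continuous_fst).mul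
      ((IsSmooth.continuous g.2).comp continuous_snd)⟩
  map_add' g h := by ext z; simp [mul_add]
  map_smul' c g := by ext z; simp; ring

/-- The function `f(x,y) = ∑_m e^{imx} f_m(y)` on the torus. -/
def toFun : TestSpace →ₗ[ℂ] C(Torus, ℂ) := Finsupp.lsum ℂ modeMap

theorem toFun_apply (f : TestSpace) (z : Torus) :
    toFun f z = ∑ m ∈ f.support, fourier m z.1 * (f m : S1 → ℂ) z.2 := by
  simp [toFun, Finsupp.sum, modeMap]

/-- The inclusion of the test space `Φ` in the auxiliary Hilbert space. -/
def toHaux : TestSpace →ₗ[ℂ] Haux :=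
  (ContinuousMap.toLp (E := ℂ) 2 (volume : Measure Torus) ℂ : C(Torus, ℂ) →ₗ[ℂ] Haux) ∘ₗ toFun

/-- The distribution `e^{-imx} δ(y, y₀)` on the torus, acting on `Φ`:
`g ↦ ∫ dx e^{-imx} g(x, y₀)`. -/
def deltaMode (m : ℤ) (y₀ : S1) : Module.Dual ℂ TestSpace where
  toFun g := ∫ x : S1, fourier (-m) x * toFun g (x, y₀)
  map_add' g h := by
    rw [← integral_add]
    · simp [mul_add]
    · exact (((fourier (-m)).continuous.mul
        ((toFun g).continuous.comp (by fun_prop))).integrable_of_hasCompactSupport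
          (HasCompactSupport.of_compactSpace _))
    · exact (((fourier (-m)).continuous.mul
        ((toFun h).continuous.comp (by fun_prop))).integrable_of_hasCompactSupport
          (HasCompactSupport.of_compactSpace _))
  map_smul' c g := by
    rw [RingHom.id_apply, smul_eq_mul, ← integral_const_mul]
    congr 1
    funext x
    simp
    ring

theorem toFun_single (m : ℤ) (g : SmoothFn) (z : Torus) :
    toFun (Finsupp.single m g) z = fourier m z.1 * (g : S1 → ℂ) z.2 := by
  rw [toFun, Finsupp.lsum_single]
  rfl

theorem integral_fourier_mul (m n : ℤ) :
    ∫ x : S1, fourier (-m) x * fourier n x = if n = m then (2 * Real.pi : ℂ) else 0 := by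
  simp_rw [← fourier_add]
  split_ifs with h
  · subst h
    simp [Measure.real, AddCircle.measure_univ, Real.pi_pos.le]
  · have hij : -m + n ≠ 0 := by omega
    exact integral_eq_zero_of_add_right_eq_neg
      (fourier_add_half_inv_index hij Real.two_pi_pos)

/-- `e^{-imx} δ(y, y₀)` applied to `g` is `2π g_m(y₀)`. -/
theorem deltaMode_apply (m : ℤ) (y₀ : S1) (g : TestSpace) :
    deltaMode m y₀ g = 2 * Real.pi * (g m : S1 → ℂ) y₀ := by
  induction g using Finsupp.induction_linear with
  | zero => simp
  | add f g hf hg => rw [map_add, hf, hg]; simp [mul_add]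
  | single n g =>
    have h1 : deltaMode m y₀ (Finsupp.single n g) =
        ∫ x : S1, (fourier (-m) x * fourier n x) * (g : S1 → ℂ) y₀ := by
      change ∫ x : S1, fourier (-m) x * toFun (Finsupp.single n g) (x, y₀) = _
      congr 1
      funext x
      rw [toFun_single, mul_assoc]
    rw [h1, integral_mul_const, integral_fourier_mul]
    by_cases h : n = m
    · subst h; simp
    · simp [h]

theorem toFun_injective : Function.Injective toFun := by
  intro f g h
  ext m y
  have h1 : deltaMode m y f = deltaMode m y g := by
    change ∫ x : S1, fourier (-m) x * toFun f (x, y) = ∫ x : S1, fourier (-m) x * toFun g (x, y)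
    rw [h]
  rw [deltaMode_apply, deltaMode_apply] at h1
  have h2 : (2 * Real.pi : ℂ) ≠ 0 := by exact_mod_cast Real.two_pi_pos.ne'
  exact mul_left_cancel₀ h2 h1

theorem toHaux_injective : Function.Injective toHaux :=
  (ContinuousMap.toLp_injective (p := 2) (𝕜 := ℂ) (volume : Measure Torus)).comp toFun_injective

/-- The operator on `Φ` that acts on the `m`-th Fourier component by `T m`. -/
def modewise (T : ℤ → SmoothFn →ₗ[ℂ] SmoothFn) : TestSpace →ₗ[ℂ] TestSpace :=
  Finsupp.lsum ℂ (fun m => Finsupp.lsingle m ∘ₗ T m)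

theorem modewise_apply (T : ℤ → SmoothFn →ₗ[ℂ] SmoothFn) (f : TestSpace) (m : ℤ) :
    modewise T f m = T m (f m) := by
  induction f using Finsupp.induction_linear with
  | zero => simp
  | add f g hf hg => rw [map_add, Finsupp.add_apply, hf, hg, Finsupp.add_apply, map_add]
  | single n g =>
    by_cases h : n = m
    · subst h; simp [modewise]
    · simp [modewise, h]

/-- Multiplication by the smooth function `a`. -/
def mulSmooth (a : S1 → ℂ) (ha : IsSmooth a) : SmoothFn →ₗ[ℂ] SmoothFn where
  toFun g := ⟨fun y => a y * (g : S1 → ℂ) y, by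
    have ha' : ContDiff ℝ ∞ (fun s : ℝ => a (s : S1)) := ha
    have hg' : ContDiff ℝ ∞ (fun s : ℝ => (g : S1 → ℂ) (s : S1)) := g.2
    exact ha'.mul hg'⟩
  map_add' g h := by ext y; simp [mul_add]
  map_smul' c g := by ext y; simp; ring

/-! ### The potential and the constraint -/

/-- The potential `R : S¹ → ℝ`: smooth, with finitely many stationary points, at each of which some
derivative of `R` of positive order does not vanish. -/
structure Potential where
  toFun : S1 → ℝ
  smooth : IsSmooth toFun
  finite_stationary : {y : S1 | circleDeriv 1 toFun y = 0}.Finite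
  finite_order : ∀ y : S1, circleDeriv 1 toFun y = 0 →
    ∃ k : ℕ, 1 ≤ k ∧ circleDeriv k toFun y ≠ 0

namespace Potential

instance : CoeFun Potential (fun _ => S1 → ℝ) := ⟨Potential.toFun⟩

variable (R : Potential)

/-- The function `m² - R(y)`, through which the constraint acts on the modes `e^{imx} f_m(y)`. -/
def symb (m : ℤ) (y : S1) : ℂ := (m : ℂ) ^ 2 - (R y : ℂ)

theorem symb_smooth (m : ℤ) : IsSmooth (R.symb m) := by
  have h : ContDiff ℝ ∞ (fun s : ℝ => R (s : S1)) := R.smooth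
  exact contDiff_const.sub (Complex.ofRealCLM.contDiff.comp h)

theorem exp_symb_smooth (t : ℝ) (m : ℤ) :
    IsSmooth (fun y => Complex.exp (-Complex.I * t * R.symb m y)) := by
  have h : ContDiff ℝ ∞ (fun s : ℝ => R.symb m (s : S1)) := R.symb_smooth m
  exact (contDiff_const.mul h).cexp

/-- The quantum constraint `Ĉ = -∂²/∂x² - R` on `Φ`, see `constraint_toFun`. -/
def constraint : TestSpace →ₗ[ℂ] TestSpace :=
  modewise (fun m => mulSmooth (R.symb m) (R.symb_smooth m))

/-- The unitary group `U(t) = e^{-itĈ}` on `Φ`: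
`(U(t) f)(x,y) = ∑_m e^{-it(m² - R(y))} e^{imx} f_m(y)`. -/
def U (t : ℝ) : TestSpace →ₗ[ℂ] TestSpace :=
  modewise (fun m => mulSmooth (fun y => Complex.exp (-Complex.I * t * R.symb m y))
    (R.exp_symb_smooth t m))

theorem U_apply (t : ℝ) (f : TestSpace) (m : ℤ) (y : S1) :
    (R.U t f m : S1 → ℂ) y = Complex.exp (-Complex.I * t * R.symb m y) * (f m : S1 → ℂ) y := by
  rw [U, modewise_apply]
  rfl

theorem U_zero (f : TestSpace) : R.U 0 f = f := by
  ext m y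
  simp [U_apply]

theorem U_add (s t : ℝ) (f : TestSpace) : R.U (s + t) f = R.U s (R.U t f) := by
  ext m y
  rw [U_apply, U_apply, U_apply, ← mul_assoc, ← Complex.exp_add]
  congr 2
  push_cast
  ring

theorem constraint_apply (f : TestSpace) (m : ℤ) (y : S1) :
    (R.constraint f m : S1 → ℂ) y = R.symb m y * (f m : S1 → ℂ) y := by
  rw [constraint, modewise_apply]
  rfl

theorem deriv_fourier_mul (m : ℤ) (c : ℂ) :
    deriv (fun r : ℝ => fourier m (r : S1) * c) =
      fun r : ℝ => fourier m (r : S1) * (Complex.I * m * c) := by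
  funext r
  have h := ((hasDerivAt_fourier (2 * Real.pi) m r).mul_const c).deriv
  rw [h]
  have h2 : (Real.pi : ℂ) ≠ 0 := by exact_mod_cast Real.pi_pos.ne'
  push_cast
  field_simp

theorem two_le_infty : (2 : WithTop ℕ∞) ≤ ∞ :=
  WithTop.coe_le_coe.2 (le_top : (2 : ℕ∞) ≤ ⊤)

theorem contDiff_toFun_fst (f : TestSpace) (y : S1) :
    ContDiff ℝ ∞ (fun r : ℝ => Boulware.toFun f ((r : S1), y)) := by
  induction f using Finsupp.induction_linear with
  | zero => simpa using contDiff_const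
  | add f g hf hg => simpa using hf.add hg
  | single n g =>
    simp only [toFun_single]
    refine ContDiff.mul ?_ contDiff_const
    simp only [fourier_coe_apply]
    refine ContDiff.cexp ?_
    exact ((contDiff_const.mul Complex.ofRealCLM.contDiff).div_const _)

/-- `constraint` is the differential operator `-∂²/∂x² - R(y)`. -/
theorem constraint_toFun (f : TestSpace) (s : ℝ) (y : S1) :
    Boulware.toFun (R.constraint f) ((s : S1), y) =
      - iteratedDeriv 2 (fun r : ℝ => Boulware.toFun f ((r : S1), y)) s
        - (R y : ℂ) * Boulware.toFun f ((s : S1), y) := by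
  induction f using Finsupp.induction_linear with
  | zero => simp
  | add f g hf hg =>
    have h : (fun r : ℝ => Boulware.toFun (f + g) ((r : S1), y)) =
        (fun r : ℝ => Boulware.toFun f ((r : S1), y)) +
          (fun r : ℝ => Boulware.toFun g ((r : S1), y)) := by
      funext r; simp
    rw [h, iteratedDeriv_add ((contDiff_toFun_fst f y).contDiffAt.of_le two_le_infty)
      ((contDiff_toFun_fst g y).contDiffAt.of_le two_le_infty)]
    rw [map_add, map_add, map_add, ContinuousMap.add_apply, ContinuousMap.add_apply, hf, hg]
    ring
  | single n g =>
    have h : R.constraint (Finsupp.single n g) =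
        Finsupp.single n (mulSmooth (R.symb n) (R.symb_smooth n) g) := by
      simp [constraint, modewise]
    rw [h]
    simp only [toFun_single]
    rw [iteratedDeriv_succ, iteratedDeriv_one, deriv_fourier_mul, deriv_fourier_mul]
    simp only [mulSmooth, symb, LinearMap.coe_mk, AddHom.coe_mk]
    linear_combination ((fourier n (s : S1) * (n : ℂ) ^ 2 * (g : S1 → ℂ) y)) * Complex.I_sq

/-- `U(t)` solves `d/dt U(t) f = -i Ĉ U(t) f`. -/
theorem hasDerivAt_U (f : TestSpace) (t : ℝ) (z : Torus) :
    HasDerivAt (fun t : ℝ => Boulware.toFun (R.U t f) z)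
      (-Complex.I * Boulware.toFun (R.constraint (R.U t f)) z) t := by
  induction f using Finsupp.induction_linear with
  | zero => simpa using hasDerivAt_const t (0 : ℂ)
  | add f g hf hg =>
    have h := hf.add hg
    rw [← mul_add, ← ContinuousMap.add_apply, ← map_add, ← map_add, ← map_add] at h
    refine h.congr_of_eventuallyEq (Filter.Eventually.of_forall fun t => ?_)
    simp
  | single n g =>
    have hU : ∀ t : ℝ, R.U t (Finsupp.single n g) = Finsupp.single n
        (mulSmooth (fun y => Complex.exp (-Complex.I * t * R.symb n y))
          (R.exp_symb_smooth t n) g) := by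
      intro t; simp [U, modewise]
    have hC : ∀ g : SmoothFn, R.constraint (Finsupp.single n g) =
        Finsupp.single n (mulSmooth (R.symb n) (R.symb_smooth n) g) := by
      intro g; simp [constraint, modewise]
    simp only [hU, hC, toFun_single, mulSmooth, LinearMap.coe_mk, AddHom.coe_mk]
    have h1 : HasDerivAt (fun t : ℝ => -Complex.I * (t : ℂ) * R.symb n z.2)
        (-Complex.I * 1 * R.symb n z.2) t :=
      ((Complex.ofRealCLM.hasDerivAt (x := t)).const_mul (-Complex.I)).mul_const _
    have h2 := ((h1.cexp.mul_const ((g : S1 → ℂ) z.2)).const_mul (fourier n z.1))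
    refine h2.congr_deriv ?_
    ring

/-! ### The observable algebra -/

/-- An element of the observable algebra `𝒜_obs`: a (possibly unbounded) operator `𝒪` on `ℋ_aux`
such that the domains of `𝒪` and `𝒪†` contain `Φ`, both map `Φ` to itself, and `𝒪` commutes with
`U(t)` on `Φ` for all `t`. (The adjoint makes sense because `Φ` is dense.) -/
structure Observable where
  op : Haux →ₗ.[ℂ] Haux
  mem_domain : ∀ φ : TestSpace, toHaux φ ∈ op.domain
  mem_adjoint_domain : ∀ φ : TestSpace, toHaux φ ∈ op.adjoint.domain
  map_test : ∀ φ : TestSpace, ∃ ψ : TestSpace, toHaux ψ = op ⟨toHaux φ, mem_domain φ⟩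
  adjoint_map_test : ∀ φ : TestSpace, ∃ ψ : TestSpace,
    toHaux ψ = op.adjoint ⟨toHaux φ, mem_adjoint_domain φ⟩
  commutes : ∀ (t : ℝ) (φ ψ : TestSpace), toHaux ψ = op ⟨toHaux φ, mem_domain φ⟩ →
    toHaux (R.U t ψ) = op ⟨toHaux (R.U t φ), mem_domain (R.U t φ)⟩

/-- The restriction to `Φ` of an operator on `ℋ_aux` that maps `Φ` to itself. -/
def restrictTest (A : Haux →ₗ.[ℂ] Haux) (hd : ∀ φ : TestSpace, toHaux φ ∈ A.domain)
    (hm : ∀ φ : TestSpace, ∃ ψ : TestSpace, toHaux ψ = A ⟨toHaux φ, hd φ⟩) :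
    TestSpace →ₗ[ℂ] TestSpace where
  toFun φ := (hm φ).choose
  map_add' φ ψ := by
    apply toHaux_injective
    have h : (⟨toHaux (φ + ψ), hd (φ + ψ)⟩ : A.domain) =
        ⟨toHaux φ, hd φ⟩ + ⟨toHaux ψ, hd ψ⟩ := Subtype.ext (map_add toHaux φ ψ)
    rw [map_add toHaux (hm φ).choose, (hm (φ + ψ)).choose_spec, (hm φ).choose_spec,
      (hm ψ).choose_spec, h, A.map_add]
  map_smul' c φ := by
    apply toHaux_injective
    have h : (⟨toHaux (c • φ), hd (c • φ)⟩ : A.domain) = c • ⟨toHaux φ, hd φ⟩ :=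
      Subtype.ext (map_smul toHaux c φ)
    rw [RingHom.id_apply, map_smul toHaux c (hm φ).choose, (hm (c • φ)).choose_spec,
      (hm φ).choose_spec, h, A.map_smul]

namespace Observable

variable {R}

/-- The action of `𝒪` on `Φ`. -/
def act (O : R.Observable) : TestSpace →ₗ[ℂ] TestSpace :=
  restrictTest O.op O.mem_domain O.map_test

theorem toHaux_act (O : R.Observable) (φ : TestSpace) :
    toHaux (O.act φ) = O.op ⟨toHaux φ, O.mem_domain φ⟩ :=
  (O.map_test φ).choose_spec

/-- The action of `𝒪†` on `Φ`. -/
def actAdj (O : R.Observable) : TestSpace →ₗ[ℂ] TestSpace :=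
  restrictTest O.op.adjoint O.mem_adjoint_domain O.adjoint_map_test

theorem toHaux_actAdj (O : R.Observable) (φ : TestSpace) :
    toHaux (O.actAdj φ) = O.op.adjoint ⟨toHaux φ, O.mem_adjoint_domain φ⟩ :=
  (O.adjoint_map_test φ).choose_spec

/-- The dual action of `𝒪` on `Φ*`: `(𝒪 u)[φ] = u[𝒪† φ]`. -/
def dualAct (O : R.Observable) : Module.Dual ℂ TestSpace →ₗ[ℂ] Module.Dual ℂ TestSpace :=
  O.actAdj.dualMap

end Observable

/-! ### Rigging maps -/

/-- Antilinear maps `Φ → Φ*`. -/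
abbrev AntiMap : Type := TestSpace →ₛₗ[starRingEnd ℂ] Module.Dual ℂ TestSpace

/-- `η(𝒪 φ) = 𝒪 (η φ)` for all `𝒪 ∈ 𝒜_obs` and `φ ∈ Φ`. -/
def Intertwines (η : AntiMap) : Prop :=
  ∀ (O : R.Observable) (φ : TestSpace), η (O.act φ) = O.dualAct (η φ)

/-- The rigging map axioms for an antilinear map `η : Φ → Φ*`. The dual action of `U(t)` on `Φ*`
is `(U(t) u)[φ] = u[U(-t) φ]`. -/
structure IsRiggingMap (η : AntiMap) : Prop where
  real : ∀ φ₁ φ₂ : TestSpace, conj (η φ₁ φ₂) = η φ₂ φ₁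
  positive : ∀ φ : TestSpace, 0 ≤ (η φ φ).re
  invariant : ∀ (t : ℝ) (φ : TestSpace), (R.U (-t)).dualMap (η φ) = η φ
  intertwines : R.Intertwines η

/-- The inner product `(η φ₁, η φ₂)_RAQ = η(φ₂)[φ₁]` on the image of `η` (for vectors outside the
image the value is irrelevant); see `raqInner_apply`. -/
def raqInner (η : AntiMap) (u v : Module.Dual ℂ TestSpace) : ℂ :=
  η (Function.invFun η v) (Function.invFun η u)

/-- The RAQ inner product does not depend on the choice of representatives. -/
theorem raqInner_apply (η : AntiMap)
    (real : ∀ φ₁ φ₂ : TestSpace, conj (η φ₁ φ₂) = η φ₂ φ₁) (φ₁ φ₂ : TestSpace) :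
    raqInner η (η φ₁) (η φ₂) = η φ₂ φ₁ := by
  have h1 : η (Function.invFun η (η φ₁)) = η φ₁ := Function.invFun_eq ⟨φ₁, rfl⟩
  have h2 : η (Function.invFun η (η φ₂)) = η φ₂ := Function.invFun_eq ⟨φ₂, rfl⟩
  rw [raqInner, h2, ← real, h1, real]

/-! ### Solutions of `q² = R(y)` -/

/-- The pairs `(m, y)` for which `y` solves `q² = R(y)` with `q = |m|`. -/
def solutions : Set (ℤ × S1) := {s | (s.1 : ℝ) ^ 2 = R s.2}

theorem circleDeriv_one_coe (s : ℝ) :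
    circleDeriv 1 R (s : S1) = deriv (fun r : ℝ => R (r : S1)) s := by
  rw [circleDeriv_coe, iteratedDeriv_one]

theorem finite_level (c : ℝ) : {y : S1 | R y = c}.Finite := by
  have hcd : ContDiff ℝ ∞ (fun r : ℝ => R (r : S1)) := R.smooth
  have hcont : Continuous (fun r : ℝ => R (r : S1)) := hcd.continuous
  set T : ℝ := 2 * Real.pi with hT
  have hTpos : 0 < T := Real.two_pi_pos
  -- the stationary points of the lift in one period
  have hZ : {r : ℝ | r ∈ Set.Ico 0 T ∧ deriv (fun r : ℝ => R (r : S1)) r = 0}.Finite := by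
    have hinj : Set.InjOn (fun r : ℝ => (r : S1)) (Set.Ico 0 T) := fun r hr r' hr' h =>
      (AddCircle.coe_eq_coe_iff_of_mem_Ico (a := 0) (by simpa using hr) (by simpa using hr')).1 h
    refine Set.Finite.of_finite_image (f := fun r : ℝ => (r : S1))
      (R.finite_stationary.subset ?_) (hinj.mono fun r hr => hr.1)
    rintro _ ⟨r, ⟨_, hr'⟩, rfl⟩
    change circleDeriv 1 R (r : S1) = 0
    rw [circleDeriv_one_coe, hr']
  have hA : {r : ℝ | r ∈ Set.Icc 0 T ∧ R (r : S1) = c}.Finite := by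
    by_contra hinf
    have hinf' : {r : ℝ | r ∈ Set.Icc 0 T ∧ R (r : S1) = c}.Infinite := hinf
    obtain ⟨a, ha, hacc⟩ := hinf'.exists_accPt_of_subset_isCompact isCompact_Icc (fun r hr => hr.1)
    have hfr := accPt_iff_frequently.1 hacc
    have hRa : R (a : S1) = c := by
      have hcl : IsClosed {r : ℝ | R (r : S1) = c} := isClosed_eq hcont continuous_const
      have h2 : ∃ᶠ y in nhds a, y ∈ {r : ℝ | R (r : S1) = c} := hfr.mono fun y hy => hy.2.2
      exact hcl.mem_of_frequently_of_tendsto h2 Filter.tendsto_id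
    have hev := ((hZ.subset (Set.sdiff_subset (t := {a}))).isClosed.isOpen_compl).mem_nhds
      (x := a) (by simp)
    obtain ⟨δ, hδ, hball⟩ := Metric.mem_nhds_iff.1 hev
    obtain ⟨x, ⟨hxa, hxI, hxc⟩, hxδ⟩ :=
      (hfr.and_eventually (Metric.ball_mem_nhds a hδ)).exists
    rw [Real.dist_eq, abs_lt] at hxδ
    have key : ∃ z, z ≠ a ∧ |z - a| < δ ∧ z ∈ Set.Ico 0 T ∧
        deriv (fun r : ℝ => R (r : S1)) z = 0 := by
      rcases lt_or_gt_of_ne hxa with h | h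
      · obtain ⟨z, hz, hz'⟩ := exists_deriv_eq_zero h hcont.continuousOn (hxc.trans hRa.symm)
        refine ⟨z, hz.2.ne, ?_, ⟨hxI.1.trans hz.1.le, hz.2.trans_le ha.2⟩, hz'⟩
        rw [abs_lt]
        constructor <;> linarith [hz.1, hz.2]
      · obtain ⟨z, hz, hz'⟩ := exists_deriv_eq_zero h hcont.continuousOn (hRa.trans hxc.symm)
        refine ⟨z, hz.1.ne', ?_, ⟨ha.1.trans hz.1.le, hz.2.trans_le hxI.2⟩, hz'⟩
        rw [abs_lt]
        constructor <;> linarith [hz.1, hz.2]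
    obtain ⟨z, hza, hzδ, hzI, hz⟩ := key
    exact hball (Metric.mem_ball.2 (by rwa [Real.dist_eq])) ⟨⟨hzI, hz⟩, hza⟩
  refine (hA.image (fun r : ℝ => (r : S1))).subset ?_
  intro y hy
  have hy' : y ∈ QuotientAddGroup.mk '' Set.Icc (0 : ℝ) (0 + T) := by
    rw [AddCircle.coe_image_Icc_eq T 0]
    trivial
  obtain ⟨r, hr, rfl⟩ := hy'
  exact ⟨r, ⟨by simpa using hr, hy⟩, rfl⟩

theorem finite_solutions : R.solutions.Finite := by
  obtain ⟨N, hN⟩ := (isCompact_range (IsSmooth.continuous R.smooth)).bddAbove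
  obtain ⟨M, hM⟩ := exists_nat_ge N
  have h := (Set.finite_Icc (-(M : ℤ) - 1) (M + 1)).biUnion
    (t := fun m => (fun y : S1 => (m, y)) '' {y : S1 | R y = (m : ℝ) ^ 2})
    (fun m _ => (R.finite_level _).image _)
  refine h.subset ?_
  rintro ⟨m, y⟩ hs
  have hs' : (m : ℝ) ^ 2 = R y := hs
  have h1 : (m : ℝ) ^ 2 ≤ M := hs' ▸ (hN ⟨y, rfl⟩).trans hM
  have h2 : m ^ 2 ≤ (M : ℤ) := by exact_mod_cast h1
  refine Set.mem_biUnion (x := m) ⟨by nlinarith, by nlinarith⟩ ⟨y, hs'.symm, rfl⟩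

/-- The order `p ≥ 1` of the lowest nonvanishing derivative of `R` at `y`. -/
def order (y : S1) : ℕ := sInf {k : ℕ | 1 ≤ k ∧ circleDeriv k R y ≠ 0}

/-- The index set `𝒫` of the orders of the solutions of `q² = R(y)`. -/
def degrees : Set ℕ := {p | ∃ (q : ℕ) (y : S1), (q : ℝ) ^ 2 = R y ∧ R.order y = p}

/-- If `p ∈ 𝒫`, then `𝒫` contains no factor of `p` smaller than `p/2`. -/
def FactorCondition : Prop :=
  ∀ p ∈ R.degrees, ∀ d ∈ R.degrees, d ∣ p → ¬ ((d : ℝ) < (p : ℝ) / 2)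

/-- No solution of `q² = R(y)` is a stationary point of `R`. -/
def IsGeneric : Prop :=
  ∀ (q : ℕ) (y : S1), (q : ℝ) ^ 2 = R y → circleDeriv 1 R y ≠ 0

/-- Labels of the maps: `p` for odd `p`, and `(p, ε)` with `ε = ±1` for even `p`. -/
inductive Label where
  | odd (p : ℕ) : Label
  | even (p : ℕ) (ε : ℤˣ) : Label

/-- The order `p` that belongs to a label. -/
def Label.p : Label → ℕ
  | .odd p => p
  | .even p _ => p

/-- The pairs `(m, y)` where `y` is one of the solutions `y_{p|m|j}` (odd `p`) or `y_{pε|m|j}`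
(even `p`, with `ε` the sign of the `p`-th derivative of `R` at `y`). -/
def sector : Label → Set (ℤ × S1)
  | .odd p => {s | s ∈ R.solutions ∧ R.order s.2 = p ∧ Odd p}
  | .even p ε => {s | s ∈ R.solutions ∧ R.order s.2 = p ∧ Even p ∧
      0 < ((ε : ℤ) : ℝ) * circleDeriv p R s.2}

theorem sector_subset (σ : Label) : R.sector σ ⊆ R.solutions := by
  cases σ <;> exact fun s hs => hs.1

theorem finite_sector (σ : Label) : (R.sector σ).Finite :=
  R.finite_solutions.subset (R.sector_subset σ)

/-- The labels for which solutions exist. -/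
def labels : Set Label := {σ | (R.sector σ).Nonempty}

theorem finite_labels : R.labels.Finite := by
  refine (R.finite_solutions.biUnion
    (t := fun s => ({.odd (R.order s.2), .even (R.order s.2) 1, .even (R.order s.2) (-1)} :
      Set Label)) fun s _ => by simp).subset ?_
  rintro σ ⟨s, hs⟩
  refine Set.mem_biUnion (R.sector_subset σ hs) ?_
  rcases σ with p | ⟨p, ε⟩
  · simp [hs.2.1]
  · rcases Int.units_eq_one_or ε with h | h <;> simp [hs.2.1, h]

/-! ### The maps `η`, `η_p` and `η_{pε}` -/

/-- The antilinear map
`f ↦ 2π ∑_{(m,y₀) ∈ S} c(m,y₀) conj(f_m(y₀)) e^{-imx} δ(y, y₀)`. -/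
def deltaMap (S : Finset (ℤ × S1)) (c : ℤ × S1 → ℂ) : AntiMap where
  toFun f := (2 * Real.pi : ℂ) •
    ∑ s ∈ S, (c s * conj ((f s.1 : S1 → ℂ) s.2)) • deltaMode s.1 s.2
  map_add' f g := by
    simp [mul_add, add_smul, Finset.sum_add_distrib]
  map_smul' a f := by
    rw [smul_comm, Finset.smul_sum (r := (starRingEnd ℂ) a)]
    congr 1
    refine Finset.sum_congr rfl fun s _ => ?_
    rw [smul_smul]
    congr 1
    simp
    ring

theorem deltaMap_apply (S : Finset (ℤ × S1)) (c : ℤ × S1 → ℂ)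
    (f g : TestSpace) :
    deltaMap S c f g = (2 * Real.pi : ℂ) ^ 2 *
      ∑ s ∈ S, c s * conj ((f s.1 : S1 → ℂ) s.2) * (g s.1 : S1 → ℂ) s.2 := by
  simp only [deltaMap, LinearMap.coe_mk, AddHom.coe_mk, LinearMap.smul_apply,
    LinearMap.sum_apply, deltaMode_apply, smul_eq_mul]
  rw [Finset.mul_sum, Finset.mul_sum]
  refine Finset.sum_congr rfl fun s _ => ?_
  ring

/-- The coefficient `1 / |R'(y)|`. -/
def genericWeight (s : ℤ × S1) : ℂ := ((1 / |circleDeriv 1 R s.2| : ℝ) : ℂ)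

/-- The map `η`, for a generic potential. -/
def eta : AntiMap := deltaMap R.finite_solutions.toFinset R.genericWeight

/-- The renormalised coefficient `|R^{(p)}(y)|^{-1/p}`. -/
def weight (σ : Label) (s : ℤ × S1) : ℂ :=
  ((1 / |circleDeriv σ.p R s.2| ^ (1 / (σ.p : ℝ)) : ℝ) : ℂ)

/-- The map `η_p` (for `σ = .odd p`) or `η_{pε}` (for `σ = .even p ε`). -/
def etaSector (σ : Label) : AntiMap := deltaMap (R.finite_sector σ).toFinset (R.weight σ)

/-- The sum of the maps `η_p` and `η_{pε}` over all labels for which solutions exist; its image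
carries the total Hilbert space. -/
def etaTot : AntiMap := ∑ σ ∈ R.finite_labels.toFinset, R.etaSector σ

/-- The image of `η` in `Φ*`. -/
abbrev image (η : AntiMap) : Submodule ℂ (Module.Dual ℂ TestSpace) :=
  LinearMap.range η

end Potential

end Boulware

end

open Boulware Boulware.Potential

/-!
The proof rests on two facts about the observables.

*Every observable preserves certain weighted sums.* Let `𝒪` be an observable, and consider its
matrix element between `e^{imx} f(y)` and `e^{inx} h(y)`. Commutation with `U(t)`, together with the
existence of the adjoint on the test space, says that the densities `u = conj((𝒪†h)_m) f` and
`v = conj(h) (𝒪f)_n` on the circle have the property that the push-forward of `u dy` along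
`R - m²` and that of `v dy` along `R - n²` have the same Fourier transform
(`Observable.integral_exp_eq`), hence are equal (`integral_comp_eq_of_forall_exp`). Both are smeared
with a test function of width `ε` supported on one side of `0`. A solution of order `p` contributes
to this, by the substitution `y = y₀ + ε^{1/p} ξ`, the value `ε^{1/p} H(ε^{1/p})` with a smooth
function `H`, which is even for even `p`; moreover `H(0)` is a constant, which depends on `p` only,
times `u(y₀) |R^{(p)}(y₀)|^{-1/p}` (`exists_local_scaling`). With `ε = δ^N`, for a common multiple
`N` of the orders, the two smeared densities become smooth functions of `δ`, and their Taylor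
coefficients of order `N/p` can be compared. Points of order `kp` also contribute to this
coefficient: `k ≥ 3` is ruled out by the factor condition, and for `k = 2` the contribution is an odd
Taylor coefficient of an even function. What remains is the equality of the sums of `u` and of `v`
over the sector, with the weights `|R^{(p)}|^{-1/p}` (`sum_sector_eq`), and this is the intertwining
property of the sector map (`intertwines_etaSector`).

*There are enough observables.* Around two solutions of one sector, `R - m²` and `R - n²` have the
same normal form `± x^p` in smooth coordinates, so that some local diffeomorphism carries one to the
other. The composition with it, cut off by bump functions, is an observable with a single matrix
element among the solutions (`exists_connecting_observable`). An intertwining map with coefficients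
`c` then satisfies `c(s') = J c(s)`, where `J` does not depend on `c`. Since the weights are such
coefficients too, `c` is a multiple of the weights (`intertwines_deltaMap_iff`).

The remaining statements are linear algebra. Test functions can be prescribed at finitely many
pairs `(m, y)`, so that the functionals `deltaMode m y` are linearly independent and the image of
each map is the span of those that belong to its sector; the sectors partition the solutions.
-/

namespace Boulware

open Filter Topology Polynomial

/-! ### Smoothness of parametric integrals and Hadamard's lemma -/

section Hadamard

variable {E : Type*} [NormedAddCommGroup E] [NormedSpace ℝ E]

theorem hasDerivAt_intervalIntegral_of_contDiff {K : ℝ × ℝ → E} (hK : ContDiff ℝ ∞ K)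
    (a b s : ℝ) :
    HasDerivAt (fun s => ∫ t in a..b, K (s, t)) (∫ t in a..b, fderiv ℝ K (s, t) (1, 0)) s := by
  have hK' : Continuous (fun z : ℝ × ℝ => fderiv ℝ K z (1, 0)) :=
    (hK.continuous_fderiv (by simp)).clm_apply continuous_const
  obtain ⟨C, hC⟩ := ((isCompact_closedBall s 1).prod
    (isCompact_uIcc (a := a) (b := b))).exists_bound_of_continuousOn hK'.continuousOn
  refine (intervalIntegral.hasDerivAt_integral_of_dominated_loc_of_deriv_le
    (F := fun s t => K (s, t)) (F' := fun s t => fderiv ℝ K (s, t) (1, 0)) (bound := fun _ => C)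
    (Metric.closedBall_mem_nhds s one_pos) (Eventually.of_forall fun x => ?_) ?_ ?_ ?_ ?_ ?_).2
  · exact (hK.continuous.comp (by fun_prop)).aestronglyMeasurable
  · exact (hK.continuous.comp (by fun_prop)).intervalIntegrable _ _
  · exact (hK'.comp (by fun_prop : Continuous fun t : ℝ => (s, t))).aestronglyMeasurable
  · exact Eventually.of_forall fun t ht x hx => hC (x, t) ⟨hx, Set.uIoc_subset_uIcc ht⟩
  · exact intervalIntegrable_const
  · refine Eventually.of_forall fun t _ x _ => ?_
    have h1 : HasFDerivAt K (fderiv ℝ K (x, t)) (x, t) :=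
      (hK.differentiable (by simp) _).hasFDerivAt
    exact h1.comp_hasDerivAt x ((hasDerivAt_id x).prodMk (hasDerivAt_const x t))

/-- An integral over a compact interval depends smoothly on a parameter if the integrand does. -/
theorem contDiff_intervalIntegral {K : ℝ × ℝ → E} (hK : ContDiff ℝ ∞ K) (a b : ℝ) :
    ContDiff ℝ ∞ (fun s => ∫ t in a..b, K (s, t)) := by
  rw [contDiff_infty]
  intro n
  induction n generalizing K with
  | zero =>
    refine contDiff_zero.2 (continuous_iff_continuousAt.2 fun s => ?_)
    exact (hasDerivAt_intervalIntegral_of_contDiff hK a b s).continuousAt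
  | succ n ih =>
    push_cast
    refine contDiff_succ_iff_deriv.2
      ⟨fun s => (hasDerivAt_intervalIntegral_of_contDiff hK a b s).differentiableAt, by simp, ?_⟩
    have h : deriv (fun s => ∫ t in a..b, K (s, t)) =
        fun s => ∫ t in a..b, fderiv ℝ K (s, t) (1, 0) :=
      funext fun s => (hasDerivAt_intervalIntegral_of_contDiff hK a b s).deriv
    rw [h]
    exact ih (K := fun z => fderiv ℝ K z (1, 0))
      ((hK.fderiv_right (m := ∞) (by simp)).clm_apply contDiff_const)

variable [CompleteSpace E]

/-- Hadamard's lemma on the line. -/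
theorem exists_contDiff_eq_add_smul {f : ℝ → E} (hf : ContDiff ℝ ∞ f) :
    ∃ g : ℝ → E, ContDiff ℝ ∞ g ∧ ∀ x, f x = f 0 + x • g x := by
  have hf' : ContDiff ℝ ∞ (deriv f) := (contDiff_infty_iff_deriv.1 hf).2
  refine ⟨fun x => ∫ t in (0 : ℝ)..1, deriv f (t * x),
    contDiff_intervalIntegral (K := fun z => deriv f (z.2 * z.1))
      (hf'.comp (contDiff_snd.mul contDiff_fst)) 0 1, fun x => ?_⟩
  have h : ∀ t ∈ Set.uIcc (0 : ℝ) 1, HasDerivAt (fun t => f (t * x)) (x • deriv f (t * x)) t := by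
    intro t _
    have h1 := (hf.differentiable (by simp) (t * x)).hasDerivAt
    simpa [Function.comp_def] using h1.scomp t ((hasDerivAt_id t).mul_const x)
  have h2 := intervalIntegral.integral_eq_sub_of_hasDerivAt h
    ((continuous_const.smul (hf'.continuous.comp (by fun_prop))).intervalIntegrable _ _)
  rw [intervalIntegral.integral_smul] at h2
  rw [h2]
  simp

/-- Taylor's formula with a smooth remainder. -/
theorem exists_taylor_contDiff {f : ℝ → E} (hf : ContDiff ℝ ∞ f) (n : ℕ) :
    ∃ (c : ℕ → E) (g : ℝ → E), ContDiff ℝ ∞ g ∧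
      ∀ x, f x = ∑ k ∈ Finset.range n, x ^ k • c k + x ^ n • g x := by
  induction n with
  | zero => exact ⟨0, f, hf, by simp⟩
  | succ n ih =>
    obtain ⟨c, g, hg, h⟩ := ih
    obtain ⟨g', hg', h'⟩ := exists_contDiff_eq_add_smul hg
    refine ⟨Function.update c n (g 0), g', hg', fun x => ?_⟩
    rw [h, h' x, Finset.sum_range_succ, Function.update_self, smul_add, ← add_assoc, smul_smul,
      pow_succ]
    congr 2
    refine Finset.sum_congr rfl fun k hk => ?_
    rw [Function.update_of_ne (Finset.mem_range.1 hk).ne]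

theorem iteratedDeriv_succ_id_mul {g : ℝ → ℝ} (hg : ContDiff ℝ ∞ g) (k : ℕ) :
    iteratedDeriv (k + 1) (fun x => x * g x) =
      fun x => x * iteratedDeriv (k + 1) g x + (k + 1) * iteratedDeriv k g x := by
  have hd : ∀ k x, HasDerivAt (iteratedDeriv k g) (iteratedDeriv (k + 1) g x) x := fun k x => by
    rw [iteratedDeriv_succ]
    exact (hg.differentiable_iteratedDeriv k (by exact_mod_cast WithTop.coe_lt_top _) x).hasDerivAt
  induction k with
  | zero =>
    funext x
    have := ((hasDerivAt_id x).mul (hd 0 x)).deriv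
    simp only [iteratedDeriv_zero, id, zero_add, iteratedDeriv_one] at this ⊢
    rw [← iteratedDeriv_one] at this ⊢
    simp only [iteratedDeriv_one] at this ⊢
    change deriv (fun x => x * g x) x = _ at this
    rw [this]
    simp; ring
  | succ k ih =>
    funext x
    rw [iteratedDeriv_succ, ih]
    have := (((hasDerivAt_id x).mul (hd (k + 1) x)).add ((hd k x).const_mul ((k : ℝ) + 1))).deriv
    simp only [id] at this
    refine this.trans ?_
    push_cast
    ring

/-- A smooth function with a zero of order `n` at `0` is `xⁿ` times a smooth function, whose value
at `0` is the `n`-th Taylor coefficient. -/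
theorem exists_eq_pow_mul {f : ℝ → ℝ} (hf : ContDiff ℝ ∞ f) (n : ℕ)
    (h0 : ∀ k < n, iteratedDeriv k f 0 = 0) :
    ∃ g : ℝ → ℝ, ContDiff ℝ ∞ g ∧ (∀ x, f x = x ^ n * g x) ∧
      iteratedDeriv n f 0 = n.factorial * g 0 := by
  induction n generalizing f with
  | zero => exact ⟨f, hf, by simp, by simp⟩
  | succ n ih =>
    obtain ⟨g, hg, h⟩ := exists_contDiff_eq_add_smul hf
    have hf0 : f 0 = 0 := by simpa using h0 0 n.succ_pos
    have hfg : f = fun x => x * g x := by funext x; rw [h x, hf0]; simp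
    have hk : ∀ k, iteratedDeriv (k + 1) f 0 = (k + 1) * iteratedDeriv k g 0 := fun k => by
      rw [hfg, iteratedDeriv_succ_id_mul hg]; simp
    obtain ⟨g', hg', h1, h2⟩ := ih hg fun k hkn => by
      have := hk k
      rw [h0 (k + 1) (by omega)] at this
      have h3 : (k : ℝ) + 1 ≠ 0 := by positivity
      simpa [h3] using this.symm
    refine ⟨g', hg', fun x => ?_, ?_⟩
    · rw [hfg]; simp only; rw [h1, pow_succ]; ring
    · rw [hk, h2, Nat.factorial_succ]; push_cast; ring

end Hadamard

/-! ### Taylor coefficients from the right -/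

/-- The function `f` has, from the right at `0`, an expansion in powers `δ^k` with a remainder of
order `L + 1`, in which `δ^L` has the coefficient `c`. The expansion is encoded as a polynomial,
whose terms beyond `δ^L` are immaterial, and the remainder as `δ^(L + 1)` times a continuous
function. -/
def HasCoeff (f : ℝ → ℂ) (L : ℕ) (c : ℂ) : Prop :=
  ∃ (Q : ℂ[X]) (g : ℝ → ℂ), Continuous g ∧ Q.coeff L = c ∧
    ∀ᶠ δ : ℝ in 𝓝[>] 0, f δ = Q.eval (δ : ℂ) + (δ : ℂ) ^ (L + 1) * g δ

namespace HasCoeff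

theorem congr {f₁ f₂ : ℝ → ℂ} {L : ℕ} {c : ℂ} (h : HasCoeff f₁ L c)
    (he : ∀ᶠ δ : ℝ in 𝓝[>] 0, f₂ δ = f₁ δ) : HasCoeff f₂ L c := by
  obtain ⟨Q, g, hg, hQ, h⟩ := h
  exact ⟨Q, g, hg, hQ, by filter_upwards [h, he] with δ h1 h2; rw [h2, h1]⟩

theorem sum {ι : Type*} (s : Finset ι) {f : ι → ℝ → ℂ} {L : ℕ} {c : ι → ℂ}
    (h : ∀ i ∈ s, HasCoeff (f i) L (c i)) :
    HasCoeff (fun δ => ∑ i ∈ s, f i δ) L (∑ i ∈ s, c i) := by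
  classical
  induction s using Finset.induction_on with
  | empty => exact ⟨0, 0, continuous_zero, by simp, by simp⟩
  | insert i s hi ih =>
    obtain ⟨Q, g, hg, hQ, h1⟩ := ih fun j hj => h j (Finset.mem_insert_of_mem hj)
    obtain ⟨Q', g', hg', hQ', h1'⟩ := h i (Finset.mem_insert_self i s)
    refine ⟨Q' + Q, g' + g, hg'.add hg, ?_, ?_⟩
    · rw [Finset.sum_insert hi, coeff_add, hQ, hQ']
    · filter_upwards [h1, h1'] with δ h2 h2'
      rw [Finset.sum_insert hi, h2, h2']
      simp
      ring

theorem coeff_eq_zero_of_eventually {Q : ℂ[X]} {g : ℝ → ℂ} (hg : Continuous g) {L : ℕ}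
    (h : ∀ᶠ δ : ℝ in 𝓝[>] 0, Q.eval (δ : ℂ) = (δ : ℂ) ^ (L + 1) * g δ) : Q.coeff L = 0 := by
  induction L generalizing Q with
  | zero =>
    have h1 : Tendsto (fun δ : ℝ => Q.eval (δ : ℂ)) (𝓝[>] 0) (𝓝 (Q.eval ((0 : ℝ) : ℂ))) :=
      ((Q.continuous.comp Complex.continuous_ofReal).tendsto 0).mono_left nhdsWithin_le_nhds
    have h2 : Tendsto (fun δ : ℝ => (δ : ℂ) ^ (0 + 1) * g δ) (𝓝[>] 0)
        (𝓝 (((0 : ℝ) : ℂ) ^ (0 + 1) * g 0)) :=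
      (((Complex.continuous_ofReal.pow _).mul hg).tendsto 0).mono_left nhdsWithin_le_nhds
    have h3 := tendsto_nhds_unique (h1.congr' h) h2
    rw [coeff_zero_eq_eval_zero]
    simpa using h3
  | succ L ih =>
    have h1 : Q.coeff 0 = 0 := by
      have h1 : Tendsto (fun δ : ℝ => Q.eval (δ : ℂ)) (𝓝[>] 0) (𝓝 (Q.eval ((0 : ℝ) : ℂ))) :=
        ((Q.continuous.comp Complex.continuous_ofReal).tendsto 0).mono_left nhdsWithin_le_nhds
      have h2 : Tendsto (fun δ : ℝ => (δ : ℂ) ^ (L + 1 + 1) * g δ) (𝓝[>] 0)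
          (𝓝 (((0 : ℝ) : ℂ) ^ (L + 1 + 1) * g 0)) :=
        (((Complex.continuous_ofReal.pow _).mul hg).tendsto 0).mono_left nhdsWithin_le_nhds
      have h3 := tendsto_nhds_unique (h1.congr' h) h2
      rw [coeff_zero_eq_eval_zero]
      simpa using h3
    have h2 : Q = X * Q.divX := by
      conv_lhs => rw [← X_mul_divX_add Q, h1]
      simp
    rw [h2, coeff_X_mul]
    refine ih ?_
    filter_upwards [h, self_mem_nhdsWithin] with δ hδ hpos
    have hne : (δ : ℂ) ≠ 0 := by exact_mod_cast (ne_of_gt hpos)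
    rw [h2, eval_mul, eval_X] at hδ
    refine mul_left_cancel₀ hne (hδ.trans ?_)
    ring

theorem unique {f : ℝ → ℂ} {L : ℕ} {c c' : ℂ} (h : HasCoeff f L c) (h' : HasCoeff f L c') :
    c = c' := by
  obtain ⟨Q, g, hg, hQ, h1⟩ := h
  obtain ⟨Q', g', hg', hQ', h1'⟩ := h'
  have := coeff_eq_zero_of_eventually (Q := Q - Q') (hg'.sub hg) (L := L) (by
    filter_upwards [h1, h1'] with δ h2 h2'
    have := h2.symm.trans h2'
    rw [eval_sub, Pi.sub_apply]
    linear_combination this)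
  rw [coeff_sub, hQ, hQ', sub_eq_zero] at this
  exact this

end HasCoeff

/-- The expansion of `δ^q H(δ^q)`, for smooth `H`, contains only the powers `δ^{(k+1)q}`. The
coefficient is computed for `k = 0`, and for `k = 1` if `H` is even. -/
theorem hasCoeff_rescale {H : ℝ → ℂ} (hH : ContDiff ℝ ∞ H) {q L : ℕ} (hq : 0 < q) {c : ℂ}
    (hdvd : ∀ k, L = (k + 1) * q → k = 0 ∧ c = H 0 ∨ k = 1 ∧ c = 0 ∧ ∀ s, H (-s) = H s)
    (hndvd : ¬ q ∣ L → c = 0) (hL : 0 < L) :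
    HasCoeff (fun δ => (δ : ℂ) ^ q * H (δ ^ q)) L c := by
  obtain ⟨a, g, hg, h⟩ := exists_taylor_contDiff hH (L + 2)
  set Q : ℂ[X] := ∑ k ∈ Finset.range (L + 2), C (a k) * X ^ k with hQdef
  have hQ : ∀ k < L + 2, Q.coeff k = a k := by
    intro k hk
    simp [hQdef, finsetSum_coeff, coeff_C_mul, coeff_X_pow, hk]
  have hev : ∀ s : ℝ, H s = Q.eval (s : ℂ) + (s : ℂ) ^ (L + 2) * g s := by
    intro s
    rw [h s, hQdef, eval_finsetSum, Complex.real_smul, Complex.ofReal_pow]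
    congr 1
    refine Finset.sum_congr rfl fun k _ => ?_
    rw [eval_mul, eval_C, eval_pow, eval_X, Complex.real_smul, Complex.ofReal_pow, mul_comm]
  refine ⟨X ^ q * expand ℂ q Q, fun δ => δ ^ (q * (L + 3) - (L + 1)) * g (δ ^ q),
    ?_, ?_, Eventually.of_forall fun δ => ?_⟩
  · have := hg.continuous
    fun_prop
  · rw [coeff_X_pow_mul']
    split_ifs with hle
    · rw [coeff_expand hq]
      split_ifs with hd
      · obtain ⟨k, hk⟩ := hd
        have hLk : L = (k + 1) * q := by
          rw [add_mul, one_mul, mul_comm k q, ← hk]; omega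
        rw [hk, Nat.mul_div_cancel_left k hq]
        rcases hdvd k hLk with ⟨rfl, rfl⟩ | ⟨rfl, rfl, heven⟩
        · rw [coeff_zero_eq_eval_zero, hev 0]
          simp
        · rw [hQ 1 (by omega)]
          -- the linear coefficients of `H(s)` and of `H(-s) = H(s)` are opposite to each other
          have h1 : HasCoeff H 1 (Q.coeff 1) :=
            ⟨Q, fun s => s ^ L * g s, (by have := hg.continuous; fun_prop), rfl,
              Eventually.of_forall fun s => by rw [hev s, pow_add]; ring⟩
          have h2 : HasCoeff H 1 ((Q.comp (-X)).coeff 1) := by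
            refine ⟨Q.comp (-X), fun s => (-s) ^ L * g (-s),
              (by have := hg.continuous; fun_prop), rfl, Eventually.of_forall fun s => ?_⟩
            rw [← heven s, hev (-s)]
            simp only [eval_comp, eval_neg, eval_X, Complex.ofReal_neg]
            rw [pow_add]
            ring
          have h3 := h1.unique h2
          have h4 : (Q.comp (-X)).coeff 1 = - Q.coeff 1 := by
            have : (-X : ℂ[X]) = C (-1) * X := by simp
            rw [this, comp_C_mul_X_coeff]; simp
          rw [h4, hQ 1 (by omega)] at h3
          exact self_eq_neg.1 h3
      · refine (hndvd fun hqL => hd ?_).symm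
        exact Nat.dvd_sub hqL dvd_rfl
    · refine (hndvd fun hqL => hle (Nat.le_of_dvd hL hqL)).symm
  · simp only
    rw [hev, eval_mul, eval_pow, eval_X, expand_eval]
    push_cast
    have h1 : q * (L + 3) = (L + 1) + (q * (L + 3) - (L + 1)) := by
      have : L + 3 ≤ q * (L + 3) := Nat.le_mul_of_pos_left _ hq
      omega
    have h2 : (δ : ℂ) ^ q * (((δ : ℂ) ^ q) ^ (L + 2)) =
        (δ : ℂ) ^ (L + 1) * (δ : ℂ) ^ (q * (L + 3) - (L + 1)) := by
      rw [← pow_add, ← h1, ← pow_mul, ← pow_add]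
      congr 1
      ring
    linear_combination (g (δ ^ q)) * h2

/-! ### Scaling of an integral concentrated near a zero of order `p` -/

/-- Near a zero of order `p` of `f`, the substitution `y = sξ` turns the integral of `u · Θ(f/s^p)`
into `s` times a smooth function of `s`. The function is even if `p` is. -/
theorem exists_local_scaling {f g : ℝ → ℝ} (hg : ContDiff ℝ ∞ g) {p : ℕ} (hp : 0 < p)
    (hfg : ∀ x, f x = x ^ p * g x) (hg0 : g 0 ≠ 0) {u : ℝ → ℂ} (hu : ContDiff ℝ ∞ u)
    {Θ : ℝ → ℝ} (hΘ : ContDiff ℝ ∞ Θ) (hsupp : ∀ x, 2 ≤ |x| → Θ x = 0) :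
    ∃ r₀ > 0, ∃ H : ℝ → ℂ, ContDiff ℝ ∞ H ∧
      (∀ r, 0 < r → r ≤ r₀ → ∀ᶠ s : ℝ in 𝓝[>] 0,
        ∫ y in -r..r, u y * Θ (f y / s ^ p) = s * H s) ∧
      (Even p → ∀ s, H (-s) = H s) ∧ H 0 = u 0 * ∫ ξ : ℝ, (Θ (g 0 * ξ ^ p) : ℂ) := by
  obtain ⟨r₀, hr₀, hball⟩ : ∃ r₀ > 0, ∀ x, |x| ≤ r₀ → |g 0| / 2 ≤ |g x| := by
    have h1 : ∀ᶠ x in 𝓝 (0 : ℝ), |g 0| / 2 < |g x| :=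
      (hg.continuous.abs.tendsto 0).eventually_const_lt (by simpa using hg0)
    obtain ⟨r, hr, h⟩ := Metric.nhds_basis_closedBall.eventually_iff.1 h1
    exact ⟨r, hr, fun x hx => (h (by simpa using hx)).le⟩
  have hg0' : 0 < |g 0| / 2 := by positivity
  -- the integrand after the substitution vanishes for `|ξ| ≥ B`, uniformly in `s`
  set B : ℝ := max 1 (2 / (|g 0| / 2)) with hB
  have hB1 : 1 ≤ B := le_max_left _ _
  have hB0 : 0 < B := one_pos.trans_le hB1
  have hBp : ∀ ξ c : ℝ, B ≤ |ξ| → |g 0| / 2 ≤ |c| → Θ (ξ ^ p * c) = 0 := by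
    intro ξ c hξ hc
    apply hsupp
    rw [abs_mul, abs_pow]
    have h1 : 2 / (|g 0| / 2) ≤ |ξ| ^ p :=
      (le_max_right _ _).trans (hξ.trans (le_self_pow₀ (hB1.trans hξ) hp.ne'))
    calc (2 : ℝ) = 2 / (|g 0| / 2) * (|g 0| / 2) := by field_simp
      _ ≤ |ξ| ^ p * |c| := by gcongr
  -- the integrand after the substitution, `f (sξ) / s ^ p` being equal to `ξ ^ p * g (sξ)`
  let K : ℝ × ℝ → ℂ := fun z => u (z.1 * z.2) * Θ (z.2 ^ p * g (z.1 * z.2))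
  have hK : ContDiff ℝ ∞ K := by
    have h1 : ContDiff ℝ ∞ (fun z : ℝ × ℝ => z.1 * z.2) := contDiff_fst.mul contDiff_snd
    exact (hu.comp h1).mul (Complex.ofRealCLM.contDiff.comp
      (hΘ.comp ((contDiff_snd.pow p).mul (hg.comp h1))))
  refine ⟨r₀, hr₀, fun s => ∫ ξ in -B..B, K (s, ξ), contDiff_intervalIntegral hK _ _, ?_, ?_, ?_⟩
  · intro r hr hrr₀
    have hev : ∀ᶠ s : ℝ in 𝓝[>] 0, s * B ≤ r := by
      have : Tendsto (fun s : ℝ => s * B) (𝓝[>] 0) (𝓝 (0 * B)) :=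
        ((continuous_mul_const B).tendsto 0).mono_left nhdsWithin_le_nhds
      rw [zero_mul] at this
      exact (this.eventually_lt_const hr).mono fun s hs => hs.le
    filter_upwards [hev, self_mem_nhdsWithin] with s hs hpos
    have hpos : 0 < s := hpos
    have h1 : ∫ y in -r..r, u y * Θ (f y / s ^ p) = s • ∫ ξ in -(r / s)..(r / s), K (s, ξ) := by
      have h2 := intervalIntegral.smul_integral_comp_mul_left (a := -(r / s)) (b := r / s)
        (fun y => u y * (Θ (f y / s ^ p) : ℂ)) s
      rw [mul_neg, mul_div_cancel₀ r hpos.ne'] at h2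
      rw [← h2]
      congr 2
      funext ξ
      have h3 : f (s * ξ) / s ^ p = ξ ^ p * g (s * ξ) := by
        rw [hfg, mul_pow]; field_simp
      simp only [K, h3]
    have hBr : B ≤ r / s := by rw [le_div_iff₀ hpos]; linarith
    rw [h1, Complex.real_smul]
    congr 1
    rw [intervalIntegral.integral_of_le (by linarith), intervalIntegral.integral_of_le (by linarith)]
    refine setIntegral_eq_of_subset_of_forall_sdiff_eq_zero measurableSet_Ioc
      (Set.Ioc_subset_Ioc (by linarith) hBr) fun ξ hξ => ?_
    have hξB : B ≤ |ξ| := by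
      by_contra hcon
      rw [not_le, abs_lt] at hcon
      exact hξ.2 ⟨hcon.1, hcon.2.le⟩
    have hξr : |s * ξ| ≤ r := by
      rw [abs_mul, abs_of_pos hpos, mul_comm, ← le_div_iff₀ hpos, abs_le]
      exact ⟨hξ.1.1.le, hξ.1.2⟩
    simp only [K]
    rw [hBp ξ _ hξB (hball _ (hξr.trans hrr₀))]
    simp
  · intro hev s
    have h1 := intervalIntegral.integral_comp_neg (a := -B) (b := B) (fun ξ => K (s, ξ))
    rw [neg_neg] at h1
    change ∫ ξ in -B..B, K (-s, ξ) = ∫ ξ in -B..B, K (s, ξ)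
    rw [← h1]
    congr 1
    funext ξ
    simp only [K, hev.neg_pow, mul_neg, neg_mul]
  · have h1 : ∀ ξ, K (0, ξ) = u 0 * (Θ (g 0 * ξ ^ p) : ℂ) := fun ξ => by
      simp [K, mul_comm (g 0)]
    simp only [h1, intervalIntegral.integral_const_mul]
    congr 1
    refine intervalIntegral.integral_eq_integral_of_support_subset fun ξ hξ => ?_
    by_contra hcon
    refine hξ ?_
    have hξB : B ≤ |ξ| := by
      by_contra hcon'
      rw [not_le, abs_lt] at hcon'
      exact hcon ⟨hcon'.1, hcon'.2.le⟩
    have := hBp ξ (g 0) hξB (by linarith)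
    rw [mul_comm] at this
    simp [this]

/-- A smooth test function supported in `[1, 2]`. Because the support lies on one side of `0`, the
two signs of an extremum of `R` are told apart. -/
noncomputable def testBump : ContDiffBump (3 / 2 : ℝ) where
  rIn := 1 / 4
  rOut := 1 / 2
  rIn_pos := by norm_num
  rIn_lt_rOut := by norm_num

theorem testBump_eq_zero_of_le {x : ℝ} (hx : x ≤ 1) : testBump x = 0 := by
  refine testBump.zero_of_le_dist ?_
  rw [Real.dist_eq, abs_of_nonpos (by linarith)]
  change (1 / 2 : ℝ) ≤ _
  linarith

theorem testBump_eq_zero_of_ge {x : ℝ} (hx : 2 ≤ x) : testBump x = 0 := by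
  refine testBump.zero_of_le_dist ?_
  rw [Real.dist_eq, abs_of_nonneg (by linarith)]
  change (1 / 2 : ℝ) ≤ _
  linarith

theorem testBump_eq_zero_of_abs {x : ℝ} (hx : 2 ≤ |x|) : testBump x = 0 := by
  rcases le_abs.1 hx with h | h
  · exact testBump_eq_zero_of_ge h
  · exact testBump_eq_zero_of_le (by linarith)

/-- The universal constant `∫ φ(ξ^p) dξ` for the test function `φ`. -/
noncomputable def bumpMoment (p : ℕ) : ℝ := ∫ ξ : ℝ, testBump (ξ ^ p)

theorem bumpMoment_pos {p : ℕ} (hp : 0 < p) : 0 < bumpMoment p := by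
  have hc : Continuous (fun ξ : ℝ => testBump (ξ ^ p)) :=
    testBump.continuous.comp (continuous_pow p)
  refine hc.integral_pos_of_hasCompactSupport_nonneg_nonzero ?_ (fun ξ => testBump.nonneg)
    (x := (3 / 2 : ℝ) ^ (1 / (p : ℝ))) ?_
  · refine HasCompactSupport.of_support_subset_isCompact (isCompact_Icc (a := -2) (b := (2 : ℝ)))
      fun ξ hξ => ?_
    rw [Set.mem_Icc, ← abs_le]
    by_contra hcon
    push Not at hcon
    refine hξ (testBump_eq_zero_of_abs ?_)
    rw [abs_pow]
    exact hcon.le.trans (le_self_pow₀ (by linarith) hp.ne')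
  · rw [one_div, Real.rpow_inv_natCast_pow (by norm_num) hp.ne']
    refine (testBump.pos_of_mem_ball ?_).ne'
    exact Metric.mem_ball_self testBump.rOut_pos

theorem integral_testBump_of_pos {p : ℕ} (hp : 0 < p) {c : ℝ} (hc : 0 < c) :
    ∫ ξ : ℝ, testBump (c * ξ ^ p) = c ^ (-(1 / (p : ℝ))) * bumpMoment p := by
  have h1 : ∀ ξ : ℝ, c * ξ ^ p = (c ^ (1 / (p : ℝ)) * ξ) ^ p := fun ξ => by
    rw [mul_pow, one_div, Real.rpow_inv_natCast_pow hc.le hp.ne']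
  simp only [h1]
  rw [Measure.integral_comp_mul_left (fun ξ : ℝ => testBump (ξ ^ p)), Real.rpow_neg hc.le,
    abs_of_pos (inv_pos.2 (Real.rpow_pos_of_pos hc _)), smul_eq_mul, bumpMoment]

theorem integral_testBump_of_odd {p : ℕ} (hp : Odd p) {c : ℝ} (hc : c ≠ 0) :
    ∫ ξ : ℝ, testBump (c * ξ ^ p) = |c| ^ (-(1 / (p : ℝ))) * bumpMoment p := by
  rw [← integral_testBump_of_pos hp.pos (abs_pos.2 hc)]
  rcases lt_or_gt_of_ne hc with h | h
  · rw [abs_of_neg h, ← integral_neg_eq_self]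
    congr 1
    funext ξ
    rw [hp.neg_pow]
    ring_nf
  · rw [abs_of_pos h]

theorem integral_testBump_of_even_neg {p : ℕ} (hp : Even p) {c : ℝ} (hc : c ≤ 0) :
    ∫ ξ : ℝ, testBump (c * ξ ^ p) = 0 := by
  have h : ∀ ξ : ℝ, testBump (c * ξ ^ p) = 0 := fun ξ =>
    testBump_eq_zero_of_le ((mul_nonpos_of_nonpos_of_nonneg hc (hp.pow_nonneg ξ)).trans one_pos.le)
  simp [h]

/-! ### Integrals over arcs of the circle -/

theorem coe_mem_ball_iff {a x r : ℝ} (hx : |x - a| ≤ Real.pi) :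
    (x : S1) ∈ Metric.ball (a : S1) r ↔ |x - a| < r := by
  have h : ‖((x - a : ℝ) : S1)‖ = |x - a| := by
    rw [AddCircle.norm_coe_eq_abs_iff _ Real.two_pi_pos.ne', abs_of_pos Real.two_pi_pos]
    linarith
  rw [Metric.mem_ball, dist_eq_norm, ← AddCircle.coe_sub, h]

theorem integral_circle_eq {F : S1 → ℂ} (a : ℝ) :
    ∫ y, F y = ∫ x in -Real.pi..Real.pi, F ((a + x : ℝ) : S1) := by
  rw [intervalIntegral.integral_comp_add_left (fun x => F (x : S1)),
    ← AddCircle.intervalIntegral_preimage (2 * Real.pi) (a + -Real.pi) F]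
  congr 1
  ring

theorem setIntegral_ball_eq {F : S1 → ℂ} (a : ℝ) {r : ℝ} (hr : 0 < r) (hrπ : r ≤ Real.pi) :
    ∫ y in Metric.ball (a : S1) r, F y = ∫ x in -r..r, F ((a + x : ℝ) : S1) := by
  rw [← integral_indicator measurableSet_ball, integral_circle_eq a,
    intervalIntegral.integral_of_le (by linarith [Real.pi_pos]),
    intervalIntegral.integral_of_le (by linarith), integral_Ioc_eq_integral_Ioo (x := -r)]
  rw [setIntegral_eq_of_subset_of_forall_sdiff_eq_zero (s := Set.Ioo (-r) r) measurableSet_Ioc]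
  · refine setIntegral_congr_fun measurableSet_Ioo fun x hx => ?_
    have hx' : |x| < r := abs_lt.2 hx
    exact Set.indicator_of_mem ((coe_mem_ball_iff (by simpa using hx'.le.trans hrπ)).2
      (by simpa using hx')) _
  · exact fun x hx => ⟨by linarith [hx.1], by linarith [hx.2]⟩
  · intro x hx
    refine Set.indicator_of_notMem (fun hmem => hx.2 (abs_lt.1 ?_)) _
    have := (coe_mem_ball_iff (by simpa using abs_le.2 ⟨hx.1.1.le, hx.1.2⟩)).1 hmem
    simpa using this

namespace Potential

variable (R : Potential)

/-! ### The order of a solution -/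

theorem order_spec (y : S1) : 1 ≤ R.order y ∧ circleDeriv (R.order y) R y ≠ 0 := by
  have h : {k : ℕ | 1 ≤ k ∧ circleDeriv k R y ≠ 0}.Nonempty := by
    by_cases h1 : circleDeriv 1 R y = 0
    · exact R.finite_order y h1
    · exact ⟨1, le_rfl, h1⟩
  exact Nat.sInf_mem h

theorem circleDeriv_eq_zero_of_lt_order {y : S1} {k : ℕ} (hk : 1 ≤ k) (hlt : k < R.order y) :
    circleDeriv k R y = 0 := by
  by_contra h
  exact Nat.notMem_of_lt_sInf hlt ⟨hk, h⟩

theorem contDiff_lift : ContDiff ℝ ∞ (fun x : ℝ => R (x : S1)) := R.smooth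

/-- Around a point of order `p`, the increment of `R` is `x ^ p` times a smooth function. -/
theorem exists_local_factor (a : ℝ) :
    ∃ g : ℝ → ℝ, ContDiff ℝ ∞ g ∧
      (∀ x : ℝ, R ((a + x : ℝ) : S1) - R (a : S1) = x ^ R.order (a : S1) * g x) ∧
      circleDeriv (R.order (a : S1)) R (a : S1) = (R.order (a : S1)).factorial * g 0 := by
  set f : ℝ → ℝ := fun x => R ((a + x : ℝ) : S1) - R (a : S1) with hf
  have hfs : ContDiff ℝ ∞ f :=
    (R.contDiff_lift.comp (contDiff_const.add contDiff_id)).sub contDiff_const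
  have hd : ∀ k, 1 ≤ k → iteratedDeriv k f 0 = circleDeriv k R (a : S1) := by
    intro k hk
    obtain ⟨k, rfl⟩ := Nat.exists_eq_succ_of_ne_zero (by omega : k ≠ 0)
    have h1 : deriv f = deriv (fun x : ℝ => R ((a + x : ℝ) : S1)) := by
      funext x; simp [hf]
    rw [circleDeriv_coe, Nat.succ_eq_add_one, iteratedDeriv_succ', h1, ← iteratedDeriv_succ',
      iteratedDeriv_comp_const_add (k + 1) (fun x : ℝ => R (x : S1)) a]
    simp only [add_zero]
  obtain ⟨g, hg, h1, h2⟩ := exists_eq_pow_mul hfs (R.order (a : S1)) fun k hk => by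
    rcases Nat.eq_zero_or_pos k with rfl | hpos
    · simp [hf]
    · rw [hd k hpos, R.circleDeriv_eq_zero_of_lt_order hpos hk]
  exact ⟨g, hg, h1, by rw [← hd _ (R.order_spec _).1, h2]⟩

/-! ### The coefficients of the pushed-forward density at a level of `R` -/

/-- The contribution of the point `y` of the level `R = E` to the coefficient of order `1/p`. -/
noncomputable def levelCoeff (e : ℝ) (p : ℕ) (u : S1 → ℂ) (y : S1) : ℂ :=
  if R.order y = p then
    u y * ((∫ ξ : ℝ, testBump (e * (circleDeriv p R y / p.factorial) * ξ ^ p) : ℝ) : ℂ)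
  else 0

/-- The expansion of the smeared pushed-forward density, restricted to a small arc. With
`ε = δ ^ N` and `N = q * order y`, the arc contributes `δ ^ q * H (δ ^ q)`. -/
theorem hasCoeff_setIntegral_ball (y : S1) {e : ℝ} (he : |e| = 1) {u : S1 → ℂ} (hu : IsSmooth u)
    {p N : ℕ} (hN : 0 < N) (hpN : p ∣ N) (hord : R.order y ∣ N)
    (hcond : p ∣ R.order y → R.order y = p ∨ R.order y = 2 * p) :
    ∃ r₀ > 0, ∀ r, 0 < r → r ≤ r₀ → HasCoeff (fun δ => ∫ z in Metric.ball y r,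
      u z * testBump (e * ((R z - R y) / δ ^ N))) (N / p) (R.levelCoeff e p u y) := by
  obtain ⟨a, rfl⟩ := QuotientAddGroup.mk_surjective y
  change ℝ at a
  change ∃ r₀ > 0, ∀ r, 0 < r → r ≤ r₀ → HasCoeff (fun δ => ∫ z in Metric.ball (a : S1) r,
      u z * testBump (e * ((R z - R (a : S1)) / δ ^ N))) (N / p) (R.levelCoeff e p u (a : S1))
  obtain ⟨g, hg, hfg, hg0⟩ := R.exists_local_factor a
  obtain ⟨hP1, hP2⟩ := R.order_spec (a : S1)
  change R.order (a : S1) ∣ N at hord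
  change p ∣ R.order (a : S1) → R.order (a : S1) = p ∨ R.order (a : S1) = 2 * p at hcond
  have hlev : R.levelCoeff e p u (a : S1) = if R.order (a : S1) = p then
      u (a : S1) * ((∫ ξ : ℝ, testBump (e * (g 0 * ξ ^ p)) : ℝ) : ℂ) else 0 := by
    unfold levelCoeff
    split_ifs with h
    · rw [h] at hg0
      rw [hg0, mul_div_cancel_left₀ _ (by exact_mod_cast p.factorial_ne_zero)]
      simp only [mul_assoc]
    · rfl
  have hg0' : g 0 ≠ 0 := fun h => hP2 (by rw [hg0, h, mul_zero])
  rw [hlev]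
  clear hlev hg0 hP2
  set P := R.order (a : S1) with hP
  have hu' : ContDiff ℝ ∞ (fun x : ℝ => u ((a + x : ℝ) : S1)) :=
    ContDiff.comp (g := fun x : ℝ => u (x : S1)) hu (contDiff_const.add contDiff_id)
  obtain ⟨r₀, hr₀, H, hH, hint, heven, hH0⟩ := exists_local_scaling
    (f := fun x => R ((a + x : ℝ) : S1) - R (a : S1)) hg hP1 hfg hg0' hu'
    (Θ := fun x => testBump (e * x)) (testBump.contDiff.comp (contDiff_const.mul contDiff_id))
    fun x hx => testBump_eq_zero_of_abs (by rwa [abs_mul, he, one_mul])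
  refine ⟨min r₀ Real.pi, lt_min hr₀ Real.pi_pos, fun r hr hrr => ?_⟩
  obtain ⟨q, hq⟩ := hord
  have hq0 : 0 < q := Nat.pos_of_ne_zero fun h => by rw [h, mul_zero] at hq; omega
  have hp0 : 0 < p := Nat.pos_of_dvd_of_pos hpN hN
  have hL : N = N / p * p := (Nat.div_mul_cancel hpN).symm
  have hL0 : 0 < N / p := Nat.div_pos (Nat.le_of_dvd hN hpN) hp0
  refine (hasCoeff_rescale hH hq0 (L := N / p) ?_ ?_ hL0).congr ?_
  · intro k hk
    have h1 : P = (k + 1) * p := by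
      have : q * P = q * ((k + 1) * p) := by
        rw [mul_comm q P, ← hq, hL, hk]; ring
      exact Nat.eq_of_mul_eq_mul_left hq0 this
    rcases hcond ⟨k + 1, by rw [h1, mul_comm]⟩ with h | h
    · left
      have hk0 : k = 0 := by
        have : (k + 1) * p = 1 * p := by rw [← h1, h, one_mul]
        have := Nat.eq_of_mul_eq_mul_right hp0 this
        omega
      refine ⟨hk0, ?_⟩
      rw [if_pos h, hH0, h, ← integral_complex_ofReal]
      simp
    · right
      have hk1 : k = 1 := by
        have : (k + 1) * p = 2 * p := by rw [← h1, h]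
        have := Nat.eq_of_mul_eq_mul_right hp0 this
        omega
      exact ⟨hk1, by rw [if_neg (by omega)], heven (by rw [h]; exact even_two_mul p)⟩
  · intro h
    refine if_neg fun hPp => h ?_
    rw [hq, hPp, Nat.mul_div_cancel_left _ hp0]
  · have htend : Tendsto (fun δ : ℝ => δ ^ q) (𝓝[>] 0) (𝓝[>] 0) := by
      refine tendsto_nhdsWithin_iff.2 ⟨?_, ?_⟩
      · have := ((continuous_pow q).tendsto (0 : ℝ)).mono_left
          (nhdsWithin_le_nhds (s := Set.Ioi 0))
        rwa [zero_pow hq0.ne'] at this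
      · filter_upwards [self_mem_nhdsWithin] with δ hδ
        exact pow_pos (Set.mem_Ioi.1 hδ) q
    filter_upwards [htend.eventually (hint r hr (hrr.trans (min_le_left _ _)))] with δ hδ
    rw [setIntegral_ball_eq a hr (hrr.trans (min_le_right _ _))]
    have h1 : (δ ^ q) ^ P = δ ^ N := by rw [← pow_mul, hq, mul_comm]
    rw [h1] at hδ
    rw [hδ]
    push_cast
    rfl

/-- The expansion of the smeared pushed-forward density of `u` along `R`, at the level `E`. -/
theorem hasCoeff_integral (E : ℝ) {e : ℝ} (he : |e| = 1) {u : S1 → ℂ} (hu : IsSmooth u)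
    {p N : ℕ} (hN : 0 < N) (hpN : p ∣ N) (hord : ∀ y, R y = E → R.order y ∣ N)
    (hcond : ∀ y, R y = E → p ∣ R.order y → R.order y = p ∨ R.order y = 2 * p) :
    HasCoeff (fun δ => ∫ z, u z * testBump (e * ((R z - E) / δ ^ N))) (N / p)
      (∑ y ∈ (R.finite_level E).toFinset, R.levelCoeff e p u y) := by
  classical
  set Y := (R.finite_level E).toFinset with hY
  have hYmem : ∀ y, y ∈ Y ↔ R y = E := fun y => by simp [hY]
  have hloc : ∀ y ∈ Y, ∃ r₀ > 0, ∀ r, 0 < r → r ≤ r₀ → HasCoeff (fun δ => ∫ z in Metric.ball y r,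
      u z * testBump (e * ((R z - E) / δ ^ N))) (N / p) (R.levelCoeff e p u y) := by
    intro y hy
    have hy' := (hYmem y).1 hy
    have := R.hasCoeff_setIntegral_ball y he hu hN hpN (hord y hy') (hcond y hy')
    rwa [hy'] at this
  choose! ρ hρ0 hρ using hloc
  -- a common radius for which the arcs are disjoint
  obtain ⟨r, hr, hrρ, hdisj⟩ : ∃ r > 0, (∀ y ∈ Y, r ≤ ρ y) ∧
      (Y : Set S1).PairwiseDisjoint (fun y => Metric.ball y r) := by
    have h1 : ∀ᶠ r : ℝ in 𝓝[>] 0, ∀ y ∈ Y, r ≤ ρ y :=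
      (Filter.eventually_all_finset Y).2 fun y hy =>
        ((eventually_le_nhds (hρ0 y hy)).filter_mono nhdsWithin_le_nhds)
    have h2 : ∀ᶠ r : ℝ in 𝓝[>] 0, ∀ z ∈ Y ×ˢ Y, z.1 ≠ z.2 → r + r ≤ dist z.1 z.2 := by
      refine (Filter.eventually_all_finset _).2 fun z _ => ?_
      by_cases hz : z.1 = z.2
      · simp [hz]
      · filter_upwards [(eventually_le_nhds
          (half_pos (dist_pos.2 hz))).filter_mono nhdsWithin_le_nhds] with r hr _
        linarith
    obtain ⟨r, ⟨h1, h2⟩, h3⟩ := ((h1.and h2).and self_mem_nhdsWithin).exists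
    exact ⟨r, h3, h1, fun y hy z hz hyz => Metric.ball_disjoint_ball
      (h2 (y, z) (Finset.mem_product.2 ⟨hy, hz⟩) hyz)⟩
  refine (HasCoeff.sum Y fun y hy => hρ y hy r hr (hrρ y hy)).congr ?_
  -- away from the arcs the integrand vanishes for small `δ`
  set V : Set S1 := ⋃ y ∈ Y, Metric.ball y r with hV
  have hVo : IsOpen V := isOpen_biUnion fun y _ => Metric.isOpen_ball
  have hRc : Continuous (R : S1 → ℝ) := IsSmooth.continuous R.smooth
  obtain ⟨η, hη, hηV⟩ : ∃ η > 0, ∀ z ∉ V, η ≤ |R z - E| := by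
    rcases Set.eq_empty_or_nonempty Vᶜ with h | h
    · exact ⟨1, one_pos, fun z hz => absurd (h ▸ hz : z ∈ (∅ : Set S1)) (Set.notMem_empty z)⟩
    · obtain ⟨z, hz, hmin⟩ := hVo.isClosed_compl.isCompact.exists_isMinOn h
        ((hRc.sub continuous_const).abs.continuousOn (s := Vᶜ) (f := fun z => |R z - E|))
      refine ⟨|R z - E|, abs_pos.2 (sub_ne_zero.2 fun hzE => hz ?_), fun w hw => hmin hw⟩
      exact Set.mem_biUnion ((hYmem z).2 hzE) (Metric.mem_ball_self hr)
  have hev : ∀ᶠ δ : ℝ in 𝓝[>] 0, 2 * δ ^ N < η := by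
    have : Tendsto (fun δ : ℝ => 2 * δ ^ N) (𝓝[>] 0) (𝓝 (2 * 0 ^ N)) :=
      ((continuous_const.mul (continuous_pow N)).tendsto 0).mono_left nhdsWithin_le_nhds
    rw [zero_pow hN.ne', mul_zero] at this
    exact this.eventually_lt_const hη
  filter_upwards [hev, self_mem_nhdsWithin] with δ hδ hpos
  have hpos : 0 < δ := hpos
  have hcont : Continuous (fun z => u z * (testBump (e * ((R z - E) / δ ^ N)) : ℂ)) :=
    hu.continuous.mul (Complex.continuous_ofReal.comp (testBump.continuous.comp
      (continuous_const.mul ((hRc.sub continuous_const).div_const _))))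
  rw [← setIntegral_eq_integral_of_forall_compl_eq_zero (s := V) fun z hz => ?_, hV,
    integral_biUnion_finset _ (fun _ _ => measurableSet_ball) hdisj]
  · exact fun y _ => (hcont.integrable_of_hasCompactSupport
      (HasCompactSupport.of_compactSpace _)).integrableOn
  · rw [testBump_eq_zero_of_abs]
    · simp
    · rw [abs_mul, he, one_mul, abs_div, abs_of_pos (pow_pos hpos N), le_div_iff₀ (pow_pos hpos N)]
      exact hδ.le.trans (hηV z hz)

end Potential

/-! ### A pushed-forward density is determined by its Fourier transform -/

theorem continuous_integral_mul_comp {T : ℝ} {u : S1 → ℂ} (hu : Continuous u)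
    {r : S1 → AddCircle T} (hr : Continuous r) [Fact (0 < T)] :
    Continuous (fun G : C(AddCircle T, ℂ) => ∫ y, u y * G (r y)) := by
  rw [continuous_iff_continuousAt]
  intro G₀
  refine continuousAt_of_dominated (bound := fun y => ‖u y‖ * (‖G₀‖ + 1))
    (Eventually.of_forall fun G => ?_) ?_ ?_ (Eventually.of_forall fun y => ?_)
  · exact (hu.mul (G.continuous.comp hr)).aestronglyMeasurable
  · filter_upwards [continuous_norm.continuousAt.eventually_lt_const
      (lt_add_one ‖G₀‖)] with G hG
    refine Eventually.of_forall fun y => ?_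
    rw [norm_mul]
    gcongr
    exact (G.norm_coe_le_norm _).trans hG.le
  · exact (hu.norm.mul continuous_const).integrable_of_hasCompactSupport
      (HasCompactSupport.of_compactSpace _)
  · exact (continuous_const.mul (continuous_eval_const (r y))).continuousAt

/-- If the push-forwards of `u dy` along `a` and of `v dy` along `b` have the same Fourier
transform, they are equal, as functionals on compactly supported continuous functions. -/
theorem integral_comp_eq_of_forall_exp {u v : S1 → ℂ} (hu : Continuous u) (hv : Continuous v)
    {a b : S1 → ℝ} (ha : Continuous a) (hb : Continuous b)
    (h : ∀ t : ℝ, ∫ y, u y * Complex.exp (Complex.I * t * a y) =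
      ∫ y, v y * Complex.exp (Complex.I * t * b y))
    {F : ℝ → ℂ} (hF : Continuous F) {B : ℝ} (hB : ∀ x, B ≤ |x| → F x = 0) :
    ∫ y, u y * F (a y) = ∫ y, v y * F (b y) := by
  obtain ⟨M₁, hM₁⟩ := isCompact_univ.exists_bound_of_continuousOn ha.continuousOn
  obtain ⟨M₂, hM₂⟩ := isCompact_univ.exists_bound_of_continuousOn hb.continuousOn
  -- `F` is extended periodically, with a period larger than the range of `a` and `b`
  set D : ℝ := max 1 (max B (max M₁ M₂)) + 1 with hD
  have hD0 : 1 < D := by linarith [le_max_left 1 (max B (max M₁ M₂))]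
  have hDB : B < D := by
    linarith [(le_max_left B (max M₁ M₂)).trans (le_max_right 1 _)]
  have hD1 : M₁ < D := by
    linarith [((le_max_left M₁ M₂).trans (le_max_right B _)).trans (le_max_right 1 _)]
  have hD2 : M₂ < D := by
    linarith [((le_max_right M₁ M₂).trans (le_max_right B _)).trans (le_max_right 1 _)]
  have : Fact (0 < 2 * D) := ⟨by linarith⟩
  have hend : F (-D) = F (-D + 2 * D) := by
    rw [hB _ (by rw [abs_neg]; exact hDB.le.trans (le_abs_self D)), hB]
    rw [abs_of_pos] <;> linarith
  let G : C(AddCircle (2 * D), ℂ) :=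
    ⟨AddCircle.liftIco (2 * D) (-D) F, AddCircle.liftIco_continuous hend hF.continuousOn⟩
  have hG : ∀ x : ℝ, |x| < D → G (x : AddCircle (2 * D)) = F x := fun x hx => by
    rw [abs_lt] at hx
    exact AddCircle.liftIco_coe_apply ⟨hx.1.le, by linarith⟩
  have hcl : ∀ G : C(AddCircle (2 * D), ℂ), ∫ y, u y * G (a y : AddCircle (2 * D)) =
      ∫ y, v y * G (b y : AddCircle (2 * D)) := by
    have hca := continuous_integral_mul_comp hu ((AddCircle.continuous_mk' (2 * D)).comp ha)
    have hcb := continuous_integral_mul_comp hv ((AddCircle.continuous_mk' (2 * D)).comp hb)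
    have hint : ∀ {w : S1 → ℂ} {c : S1 → ℝ} (G : C(AddCircle (2 * D), ℂ)), Continuous w →
        Continuous c → Integrable (fun y => w y * G (c y : AddCircle (2 * D))) := by
      intro w c G hw hc
      exact (hw.mul (G.continuous.comp ((AddCircle.continuous_mk'
        (2 * D)).comp hc))).integrable_of_hasCompactSupport (HasCompactSupport.of_compactSpace _)
    have hspan : Submodule.span ℂ (Set.range (@fourier (2 * D))) ≤
        ({ carrier := {G | ∫ y, u y * G (a y : AddCircle (2 * D)) =
              ∫ y, v y * G (b y : AddCircle (2 * D))}
           add_mem' := fun {G G'} hG hG' => by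
            simp only [Set.mem_ofPred_eq, ContinuousMap.add_apply, mul_add] at hG hG' ⊢
            rw [integral_add (hint G hu ha) (hint G' hu ha),
              integral_add (hint G hv hb) (hint G' hv hb), hG, hG']
           zero_mem' := by simp
           smul_mem' := fun c G hG => by
            simp only [Set.mem_ofPred_eq, ContinuousMap.smul_apply, smul_eq_mul,
              mul_left_comm _ c] at hG ⊢
            rw [integral_const_mul, integral_const_mul, hG] } :
          Submodule ℂ C(AddCircle (2 * D), ℂ)) := by
      rw [Submodule.span_le]
      rintro _ ⟨n, rfl⟩
      have := h (2 * Real.pi * n / (2 * D))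
      simp only [SetLike.mem_coe, Submodule.mem_mk, AddSubmonoid.mem_mk, AddSubsemigroup.mem_mk,
        Set.mem_ofPred_eq, fourier_coe_apply]
      convert this using 4 <;>
      · congr 1
        push_cast
        ring
    intro G
    have hmem : G ∈ (Submodule.span ℂ (Set.range (@fourier (2 * D)))).topologicalClosure := by
      rw [span_fourier_closure_eq_top]; trivial
    exact closure_minimal hspan (isClosed_eq hca hcb) hmem
  have := hcl G
  simp only [hG _ ((hM₁ _ (Set.mem_univ _)).trans_lt hD1),
    hG _ ((hM₂ _ (Set.mem_univ _)).trans_lt hD2)] at this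
  exact this

/-! ### The test space inside the auxiliary Hilbert space -/

theorem inner_toHaux_single (n : ℤ) (h : SmoothFn) (g : TestSpace) :
    ⟪toHaux (Finsupp.single n h), toHaux g⟫_ℂ =
      2 * Real.pi * ∫ y, conj ((h : S1 → ℂ) y) * (g n : S1 → ℂ) y := by
  have hint : ∀ k : SmoothFn, Integrable (fun y => conj ((h : S1 → ℂ) y) * (k : S1 → ℂ) y) :=
    fun k => ((Complex.continuous_conj.comp (IsSmooth.continuous h.2)).mul
      (IsSmooth.continuous k.2)).integrable_of_hasCompactSupport
        (HasCompactSupport.of_compactSpace _)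
  induction g using Finsupp.induction_linear with
  | zero => simp
  | add f g hf hg =>
    rw [map_add, inner_add_right, hf, hg, ← mul_add, ← integral_add (hint _) (hint _)]
    simp [mul_add]
  | single m k =>
    have h1 : ⟪toHaux (Finsupp.single n h), toHaux (Finsupp.single m k)⟫_ℂ =
        ∫ z : Torus, toFun (Finsupp.single m k) z * conj (toFun (Finsupp.single n h) z) :=
      ContinuousMap.inner_toLp (volume : Measure Torus) _ _
    have h2 : ∀ z : Torus, toFun (Finsupp.single m k) z * conj (toFun (Finsupp.single n h) z) =
        (fourier (-n) z.1 * fourier m z.1) * (conj ((h : S1 → ℂ) z.2) * (k : S1 → ℂ) z.2) :=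
      fun z => by
        rw [toFun_single, toFun_single, map_mul, ← fourier_neg]; ring
    rw [h1]
    simp only [h2]
    rw [Measure.volume_eq_prod, integral_prod_mul (fun x : S1 => fourier (-n) x * fourier m x)
      (fun y : S1 => conj ((h : S1 → ℂ) y) * (k : S1 → ℂ) y), integral_fourier_mul]
    by_cases hmn : m = n
    · subst hmn; simp
    · simp [hmn]

theorem inner_toHaux_single_right (m : ℤ) (k : SmoothFn) (g : TestSpace) :
    ⟪toHaux g, toHaux (Finsupp.single m k)⟫_ℂ =
      2 * Real.pi * ∫ y, conj ((g m : S1 → ℂ) y) * (k : S1 → ℂ) y := by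
  rw [← inner_conj_symm, inner_toHaux_single, map_mul, ← integral_conj]
  congr 1
  · rw [map_mul, Complex.conj_ofReal, Complex.conj_ofNat]
  · congr 1
    funext y
    rw [map_mul, Complex.conj_conj, mul_comm]

theorem isSmooth_fourier (n : ℤ) : IsSmooth (fun y : S1 => (fourier n y : ℂ)) := by
  unfold IsSmooth
  simp only [fourier_coe_apply]
  exact ((contDiff_const.mul Complex.ofRealCLM.contDiff).div_const _).cexp

/-- The test space is dense in the auxiliary Hilbert space. -/
theorem denseRange_toHaux : DenseRange toHaux := by
  have h1 : DenseRange (ContinuousMap.toLp (E := ℂ) 2 (volume : Measure Torus) ℂ) :=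
    ContinuousMap.toLp_denseRange ℂ _ ℂ (by simp)
  have h2 : DenseRange toFun := by
    let χ : ℤ × ℤ → C(Torus, ℂ) := fun k =>
      (fourier k.1).comp ContinuousMap.fst * (fourier k.2).comp ContinuousMap.snd
    let M : Submonoid C(Torus, ℂ) :=
      { carrier := Set.range χ
        one_mem' := ⟨0, by ext z; simp [χ]⟩
        mul_mem' := by
          rintro _ _ ⟨k, rfl⟩ ⟨l, rfl⟩
          exact ⟨k + l, by ext z; simp [χ]; ring⟩ }
    let A : StarSubalgebra ℂ C(Torus, ℂ) :=
      { Algebra.adjoin ℂ (M : Set C(Torus, ℂ)) with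
        star_mem' := by
          change Algebra.adjoin ℂ (M : Set C(Torus, ℂ)) ≤
            star (Algebra.adjoin ℂ (M : Set C(Torus, ℂ)))
          refine Algebra.adjoin_le ?_
          rintro - ⟨k, rfl⟩
          refine Algebra.subset_adjoin ⟨-k, ?_⟩
          ext z
          simp [χ] }
    have hA : A.SeparatesPoints := by
      intro z w hzw
      by_cases h : z.1 = w.1
      · have h' : z.2 ≠ w.2 := fun h' => hzw (Prod.ext h h')
        refine ⟨_, ⟨χ (0, 1), Algebra.subset_adjoin ⟨(0, 1), rfl⟩, rfl⟩, ?_⟩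
        simp only [χ, ContinuousMap.mul_apply, ContinuousMap.comp_apply, ContinuousMap.snd_apply,
          fourier_zero, one_mul, fourier_one]
        exact fun h2 => h' (AddCircle.injective_toCircle Real.two_pi_pos.ne' (Subtype.ext h2))
      · refine ⟨_, ⟨χ (1, 0), Algebra.subset_adjoin ⟨(1, 0), rfl⟩, rfl⟩, ?_⟩
        simp only [χ, ContinuousMap.mul_apply, ContinuousMap.comp_apply, ContinuousMap.fst_apply,
          fourier_zero, mul_one, fourier_one]
        exact fun h2 => h (AddCircle.injective_toCircle Real.two_pi_pos.ne' (Subtype.ext h2))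
    have hAr : (A : Set C(Torus, ℂ)) ⊆ Set.range toFun := by
      have h3 : Subalgebra.toSubmodule (Algebra.adjoin ℂ (M : Set C(Torus, ℂ))) ≤
          LinearMap.range toFun := by
        rw [Algebra.adjoin_eq_span, Submonoid.closure_eq, Submodule.span_le]
        rintro _ ⟨k, rfl⟩
        refine ⟨Finsupp.single k.1 ⟨_, isSmooth_fourier k.2⟩, ?_⟩
        ext z
        rw [toFun_single]
        rfl
      exact fun f hf => h3 hf
    have hcl := ContinuousMap.starSubalgebra_topologicalClosure_eq_top_of_separatesPoints A hA
    have hcl' : closure (A : Set C(Torus, ℂ)) = Set.univ := by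
      have := congrArg (fun B : StarSubalgebra ℂ C(Torus, ℂ) => (B : Set C(Torus, ℂ))) hcl
      simpa using this
    intro f
    exact closure_mono hAr (hcl' ▸ Set.mem_univ f)
  exact h1.comp h2 (ContinuousMap.toLp (E := ℂ) 2 (volume : Measure Torus) ℂ).continuous

namespace Potential

variable {R : Potential}

namespace Observable

theorem inner_act (O : R.Observable) (φ ψ : TestSpace) :
    ⟪toHaux ψ, toHaux (O.act φ)⟫_ℂ = ⟪toHaux (O.actAdj ψ), toHaux φ⟫_ℂ := by
  have hd : Dense (O.op.domain : Set Haux) := denseRange_toHaux.mono (by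
    rintro _ ⟨φ, rfl⟩; exact O.mem_domain φ)
  have := LinearPMap.adjoint_isFormalAdjoint hd ⟨toHaux ψ, O.mem_adjoint_domain ψ⟩
    ⟨toHaux φ, O.mem_domain φ⟩
  rw [toHaux_act, toHaux_actAdj]
  exact this.symm

theorem act_U (O : R.Observable) (t : ℝ) (φ : TestSpace) :
    O.act (R.U t φ) = R.U t (O.act φ) := by
  apply toHaux_injective
  rw [toHaux_act, O.commutes t φ _ (toHaux_act O φ)]

/-- A pair of formally adjoint operators on the test space that commute with `U(t)` comes from an
observable. -/
theorem exists_of_formalAdjoint (A B : TestSpace →ₗ[ℂ] TestSpace)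
    (hAB : ∀ φ ψ, ⟪toHaux ψ, toHaux (A φ)⟫_ℂ = ⟪toHaux (B ψ), toHaux φ⟫_ℂ)
    (hU : ∀ t φ, A (R.U t φ) = R.U t (A φ)) :
    ∃ O : R.Observable, O.act = A ∧ O.actAdj = B := by
  obtain ⟨T, hmem, hsurj, hT⟩ : ∃ T : Haux →ₗ.[ℂ] Haux, (∀ φ, toHaux φ ∈ T.domain) ∧
      (∀ x ∈ T.domain, ∃ φ, toHaux φ = x) ∧ ∀ φ h, T ⟨toHaux φ, h⟩ = toHaux (A φ) := by
    let e := LinearEquiv.ofInjective toHaux toHaux_injective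
    refine ⟨⟨LinearMap.range toHaux, toHaux ∘ₗ A ∘ₗ e.symm⟩, fun φ => ⟨φ, rfl⟩,
      fun x hx => hx, fun φ h => ?_⟩
    change toHaux (A (e.symm (e φ))) = _
    rw [e.symm_apply_apply]
  have hd : Dense (T.domain : Set Haux) := denseRange_toHaux.mono (by
    rintro _ ⟨φ, rfl⟩; exact hmem φ)
  have hx : ∀ (ψ : TestSpace) (x : T.domain),
      ⟪toHaux (B ψ), (x : Haux)⟫_ℂ = ⟪toHaux ψ, T x⟫_ℂ := by
    rintro ψ ⟨x, hx⟩
    obtain ⟨φ, rfl⟩ := hsurj x hx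
    rw [hT, hAB]
  have hadj : ∀ ψ : TestSpace, toHaux ψ ∈ T.adjoint.domain := fun ψ =>
    LinearPMap.mem_adjoint_domain_of_exists _ ⟨toHaux (B ψ), hx ψ⟩
  have hadj' : ∀ ψ : TestSpace, T.adjoint ⟨toHaux ψ, hadj ψ⟩ = toHaux (B ψ) := fun ψ =>
    LinearPMap.adjoint_apply_eq hd ⟨_, hadj ψ⟩ (hx ψ)
  let O : R.Observable :=
    { op := T
      mem_domain := hmem
      mem_adjoint_domain := hadj
      map_test := fun φ => ⟨A φ, (hT φ _).symm⟩
      adjoint_map_test := fun ψ => ⟨B ψ, (hadj' ψ).symm⟩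
      commutes := fun t φ ψ h => by
        rw [hT] at h ⊢
        rw [toHaux_injective h, hU] }
  refine ⟨O, LinearMap.ext fun φ => ?_, LinearMap.ext fun ψ => ?_⟩
  · apply toHaux_injective
    rw [toHaux_act]
    exact hT φ _
  · apply toHaux_injective
    rw [toHaux_actAdj]
    exact hadj' ψ

end Observable

end Potential

theorem IsSmooth.mul {f g : S1 → ℂ} (hf : IsSmooth f) (hg : IsSmooth g) :
    IsSmooth (fun y => f y * g y) :=
  ContDiff.mul (f := fun s : ℝ => f (s : S1)) (g := fun s : ℝ => g (s : S1)) hf hg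

theorem IsSmooth.conj {f : S1 → ℂ} (hf : IsSmooth f) : IsSmooth (fun y => conj (f y)) :=
  Complex.conjCLE.contDiff.comp (f := fun s : ℝ => f (s : S1)) hf

namespace Potential

variable (R : Potential)

/-! ### The averages over a sector that the observables preserve -/

/-- The sign with which the values of `R` are rescaled to detect a sector. -/
def Label.sign : Label → ℝ
  | .odd _ => 1
  | .even _ ε => ((ε : ℤ) : ℝ)

theorem Label.abs_sign (σ : Label) : |σ.sign| = 1 := by
  rcases σ with p | ⟨p, ε⟩
  · simp [Label.sign]
  · rcases Int.units_eq_one_or ε with h | h <;> simp [Label.sign, h]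

variable {R}

theorem order_eq_of_mem_sector {σ : Label} {s : ℤ × S1} (hs : s ∈ R.sector σ) :
    R.order s.2 = σ.p := by
  cases σ <;> exact hs.2.1

theorem mem_degrees_of_mem_solutions {m : ℤ} {y : S1} (h : R y = (m : ℝ) ^ 2) :
    R.order y ∈ R.degrees :=
  ⟨m.natAbs, y, by rw [h, ← sq_abs (m : ℝ), ← Int.cast_abs, Int.abs_eq_natAbs]; simp, rfl⟩

theorem Label.p_mem_degrees {σ : Label} (hσ : σ ∈ R.labels) : σ.p ∈ R.degrees := by
  obtain ⟨s, hs⟩ := hσ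
  rw [← order_eq_of_mem_sector hs]
  exact mem_degrees_of_mem_solutions (m := s.1) (R.sector_subset σ hs).symm

theorem eq_or_eq_two_mul_of_dvd (hF : R.FactorCondition) {d p : ℕ} (hd : d ∈ R.degrees)
    (hp : p ∈ R.degrees) (hp0 : 0 < p) (hdvd : d ∣ p) : p = d ∨ p = 2 * d := by
  obtain ⟨k, rfl⟩ := hdvd
  have h := hF _ hp d hd ⟨k, rfl⟩
  have hd0 : 0 < d := Nat.pos_of_ne_zero fun h => by simp [h] at hp0
  have hd0' : (0 : ℝ) < d := by exact_mod_cast hd0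
  have hk : k ≤ 2 := by
    by_contra hk
    apply h
    have : (3 : ℝ) ≤ k := by exact_mod_cast (by omega : 3 ≤ k)
    push_cast
    nlinarith
  have hk0 : k ≠ 0 := fun h => by simp [h] at hp0
  interval_cases k
  · exact absurd rfl hk0
  · left; simp
  · right; ring

/-- The constant, common to all points of order `p`, by which the coefficient of the pushed-forward
density exceeds the renormalised weight. -/
noncomputable def densityFactor (p : ℕ) : ℝ :=
  (p.factorial : ℝ) ^ (1 / (p : ℝ)) * bumpMoment p

/-- The point `y` contributes to the coefficient of the sector `σ` only if it belongs to it, and then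
with the renormalised weight. -/
theorem levelCoeff_eq {σ : Label} (hσ : σ ∈ R.labels) (u : S1 → ℂ) {m : ℤ} {y : S1}
    (hy : R y = (m : ℝ) ^ 2) [Decidable ((m, y) ∈ R.sector σ)] :
    R.levelCoeff σ.sign σ.p u y = if (m, y) ∈ R.sector σ then
      densityFactor σ.p * (R.weight σ (m, y) * u y) else 0 := by
  have hsol : (m, y) ∈ R.solutions := hy.symm
  by_cases hp : R.order y = σ.p
  swap
  · rw [levelCoeff, if_neg hp, if_neg fun h => hp (order_eq_of_mem_sector h)]
  have hD : circleDeriv σ.p R y ≠ 0 := hp ▸ (R.order_spec y).2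
  have hp0 : 0 < σ.p := hp ▸ (R.order_spec y).1
  have hfac : (0 : ℝ) < σ.p.factorial := by exact_mod_cast σ.p.factorial_pos
  have habs : |σ.sign * (circleDeriv σ.p R y / σ.p.factorial)| =
      |circleDeriv σ.p R y| / σ.p.factorial := by
    rw [abs_mul, Label.abs_sign, one_mul, abs_div, abs_of_pos hfac]
  have hval : (∫ ξ : ℝ, testBump (σ.sign * (circleDeriv σ.p R y / σ.p.factorial) * ξ ^ σ.p)) =
      |σ.sign * (circleDeriv σ.p R y / σ.p.factorial)| ^ (-(1 / (σ.p : ℝ))) * bumpMoment σ.p →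
      R.levelCoeff σ.sign σ.p u y = densityFactor σ.p * (R.weight σ (m, y) * u y) := by
    intro h
    rw [levelCoeff, if_pos hp, h, habs, Real.rpow_neg (by positivity),
      Real.div_rpow (abs_nonneg _) hfac.le, weight, densityFactor]
    push_cast
    field_simp
  have hmem : (0 : ℝ) < σ.sign * circleDeriv σ.p R y ↔
      0 < σ.sign * (circleDeriv σ.p R y / σ.p.factorial) := by
    rw [← mul_div_assoc, div_pos_iff_of_pos_right hfac]
  rcases σ with p | ⟨p, ε⟩
  · obtain ⟨s, hs⟩ := hσ
    have hodd : Odd p := hs.2.2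
    rw [if_pos ⟨hsol, hp, hodd⟩]
    refine hval (integral_testBump_of_odd hodd ?_)
    simp only [Label.sign, one_mul]
    exact div_ne_zero hD hfac.ne'
  · obtain ⟨s, hs⟩ := hσ
    have heven : Even p := hs.2.2.1
    split_ifs with h
    · have h1 := hmem.1 h.2.2.2
      exact hval ((integral_testBump_of_pos hp0 h1).trans (by rw [abs_of_pos h1]))
    · have h1 : ¬ 0 < (Label.even p ε).sign * circleDeriv p R y := fun h1 =>
        h ⟨hsol, hp, heven, h1⟩
      rw [levelCoeff, if_pos hp]
      have h2 := integral_testBump_of_even_neg heven (not_lt.1 (mt hmem.2 h1))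
      rw [show (∫ ξ : ℝ, testBump ((Label.even p ε).sign * (circleDeriv (Label.even p ε).p R y /
        ((Label.even p ε).p.factorial : ℝ)) * ξ ^ (Label.even p ε).p)) = 0 from h2]
      simp

theorem sum_levelCoeff_eq {σ : Label} (hσ : σ ∈ R.labels) (u : S1 → ℂ)
    (m : ℤ) :
    ∑ y ∈ (R.finite_level ((m : ℝ) ^ 2)).toFinset, R.levelCoeff σ.sign σ.p u y =
      densityFactor σ.p * ∑ s ∈ (R.finite_sector σ).toFinset.filter (fun s => s.1 = m),
        R.weight σ s * u s.2 := by
  classical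
  rw [Finset.mul_sum]
  have h1 : ∀ y ∈ (R.finite_level ((m : ℝ) ^ 2)).toFinset, R.levelCoeff σ.sign σ.p u y =
      if (m, y) ∈ R.sector σ then densityFactor σ.p * (R.weight σ (m, y) * u y) else 0 :=
    fun y hy => levelCoeff_eq hσ u (by simpa using hy)
  rw [Finset.sum_congr rfl h1, ← Finset.sum_filter]
  refine Finset.sum_bij' (fun y _ => (m, y)) (fun s _ => s.2) ?_ ?_ ?_ ?_ ?_
  · intro y hy
    simp only [Finset.mem_filter, Set.Finite.mem_toFinset] at hy ⊢
    exact ⟨hy.2, trivial⟩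
  · intro s hs
    simp only [Finset.mem_filter, Set.Finite.mem_toFinset] at hs ⊢
    obtain ⟨hs, rfl⟩ := hs
    exact ⟨(R.sector_subset σ hs).symm, hs⟩
  · intro y _; rfl
  · intro s hs
    simp only [Finset.mem_filter, Set.Finite.mem_toFinset] at hs
    exact Prod.ext hs.2.symm rfl
  · intro y _; rfl

/-- If the densities `u dy` and `v dy` have the same push-forward along `R - m²` and `R - n²`, then
their weighted sums over the solutions of a sector in the modes `m` and `n` agree. This compares
the terms of order `ε^{1/p - 1}` in the two push-forwards. A point of order `k p` contributes to
that order as well, but `k ≥ 3` is excluded by the factor condition, and the contribution for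
`k = 2` vanishes by parity. -/
theorem sum_sector_eq (hF : R.FactorCondition) {σ : Label}
    (hσ : σ ∈ R.labels) {u v : S1 → ℂ} (hu : IsSmooth u) (hv : IsSmooth v) {m n : ℤ}
    (h : ∀ t : ℝ, ∫ y, u y * Complex.exp (Complex.I * t * (R y - (m : ℝ) ^ 2 : ℝ)) =
      ∫ y, v y * Complex.exp (Complex.I * t * (R y - (n : ℝ) ^ 2 : ℝ))) :
    ∑ s ∈ (R.finite_sector σ).toFinset.filter (fun s => s.1 = m), R.weight σ s * u s.2 =
      ∑ s ∈ (R.finite_sector σ).toFinset.filter (fun s => s.1 = n), R.weight σ s * v s.2 := by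
  have hRc : Continuous (R : S1 → ℝ) := IsSmooth.continuous R.smooth
  have hpσ := Label.p_mem_degrees hσ
  have hp0 : 0 < σ.p := by
    obtain ⟨s, hs⟩ := hσ
    rw [← order_eq_of_mem_sector hs]
    exact (R.order_spec _).1
  -- with `ε = δ^N` for a common multiple `N` of the orders, all exponents become integral
  set N : ℕ := ∏ s ∈ R.finite_solutions.toFinset, R.order s.2 with hNdef
  have hN : 0 < N := Finset.prod_pos fun s _ => (R.order_spec s.2).1
  have hord : ∀ (m : ℤ) (y : S1), R y = (m : ℝ) ^ 2 → R.order y ∣ N := fun m y hy =>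
    Finset.dvd_prod_of_mem (fun s : ℤ × S1 => R.order s.2) (a := (m, y))
      (R.finite_solutions.mem_toFinset.2 hy.symm)
  have hpN : σ.p ∣ N := by
    obtain ⟨s, hs⟩ := hσ
    rw [← order_eq_of_mem_sector hs]
    exact hord s.1 s.2 (R.sector_subset σ hs).symm
  have hcond : ∀ (m : ℤ) (y : S1), R y = (m : ℝ) ^ 2 → σ.p ∣ R.order y →
      R.order y = σ.p ∨ R.order y = 2 * σ.p := fun m y hy hd =>
    eq_or_eq_two_mul_of_dvd hF hpσ (mem_degrees_of_mem_solutions hy) (R.order_spec y).1 hd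
  have h1 := R.hasCoeff_integral ((m : ℝ) ^ 2) σ.abs_sign hu hN hpN (hord m) (hcond m)
  have h2 := R.hasCoeff_integral ((n : ℝ) ^ 2) σ.abs_sign hv hN hpN (hord n) (hcond n)
  have h3 := h1.unique (h2.congr (by
    filter_upwards [self_mem_nhdsWithin] with δ hδ
    have hδ : 0 < δ ^ N := pow_pos (Set.mem_Ioi.1 hδ) N
    refine integral_comp_eq_of_forall_exp hu.continuous hv.continuous
      (hRc.sub continuous_const) (hRc.sub continuous_const) h
      (F := fun x => (testBump (σ.sign * (x / δ ^ N)) : ℂ))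
      (Complex.continuous_ofReal.comp (testBump.continuous.comp
        (continuous_const.mul (continuous_id.div_const _)))) (B := 2 * δ ^ N) fun x hx => ?_
    rw [testBump_eq_zero_of_abs]
    · simp
    · rwa [abs_mul, σ.abs_sign, one_mul, abs_div, abs_of_pos hδ, le_div_iff₀ hδ]))
  rw [sum_levelCoeff_eq hσ, sum_levelCoeff_eq hσ] at h3
  refine mul_left_cancel₀ ?_ h3
  have : 0 < densityFactor σ.p :=
    mul_pos (Real.rpow_pos_of_pos (by exact_mod_cast σ.p.factorial_pos) _) (bumpMoment_pos hp0)
  exact_mod_cast this.ne'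

/-! ### The sector maps intertwine with the observables -/

theorem U_single (t : ℝ) (m : ℤ) (f : SmoothFn) :
    R.U t (Finsupp.single m f) = Finsupp.single m
      (mulSmooth (fun y => Complex.exp (-Complex.I * t * R.symb m y))
        (R.exp_symb_smooth t m) f) := by
  simp [U, modewise]

/-- The commutation of an observable with `U(t)`, in terms of matrix elements between modes. -/
theorem Observable.integral_exp_eq (O : R.Observable) (m n : ℤ) (f h : SmoothFn) (t : ℝ) :
    ∫ y, (conj ((O.actAdj (Finsupp.single n h) m : S1 → ℂ) y) * (f : S1 → ℂ) y) *
        Complex.exp (Complex.I * t * (R y - (m : ℝ) ^ 2 : ℝ)) =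
      ∫ y, (conj ((h : S1 → ℂ) y) * (O.act (Finsupp.single m f) n : S1 → ℂ) y) *
        Complex.exp (Complex.I * t * (R y - (n : ℝ) ^ 2 : ℝ)) := by
  have h1 := O.inner_act (R.U t (Finsupp.single m f)) (Finsupp.single n h)
  rw [inner_toHaux_single, O.act_U, U_single, inner_toHaux_single_right] at h1
  have h2 : (2 * Real.pi : ℂ) ≠ 0 := by exact_mod_cast Real.two_pi_pos.ne'
  have h3 := (mul_left_cancel₀ h2 h1).symm
  have hexp : ∀ (k : ℤ) (y : S1), Complex.exp (Complex.I * t * (R y - (k : ℝ) ^ 2 : ℝ)) =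
      Complex.exp (-Complex.I * t * R.symb k y) := fun k y => by
    congr 1
    simp only [symb]
    push_cast
    ring
  simp only [hexp]
  convert h3 using 2
  · funext y
    simp only [mulSmooth, LinearMap.coe_mk, AddHom.coe_mk]
    ring
  · funext y
    rw [U_apply]
    ring

theorem intertwines_etaSector (hF : R.FactorCondition) {σ : Label} (hσ : σ ∈ R.labels) :
    R.Intertwines (R.etaSector σ) := by
  classical
  intro O φ
  refine LinearMap.ext fun g => ?_
  change R.etaSector σ (O.act φ) g = R.etaSector σ φ (O.actAdj g)
  induction φ using Finsupp.induction_linear with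
  | zero => simp
  | add φ φ' h h' => simp only [map_add, LinearMap.add_apply, h, h']
  | single m f =>
    induction g using Finsupp.induction_linear with
    | zero => simp
    | add g g' h h' => simp only [map_add, h, h']
    | single n h =>
      have h1 := sum_sector_eq hF hσ
        ((IsSmooth.conj (O.actAdj (Finsupp.single n h) m).2).mul f.2)
        ((IsSmooth.conj h.2).mul (O.act (Finsupp.single m f) n).2)
        (O.integral_exp_eq m n f h)
      have h2 := congrArg (starRingEnd ℂ) h1
      have hw : ∀ s, conj (R.weight σ s) = R.weight σ s := fun s => Complex.conj_ofReal _
      simp only [Finset.sum_filter, map_sum] at h2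
      rw [etaSector, deltaMap_apply, deltaMap_apply]
      congr 1
      convert h2.symm using 1
      · refine Finset.sum_congr rfl fun s _ => ?_
        by_cases hs : s.1 = n
        · rw [if_pos hs, hs, Finsupp.single_eq_same]
          simp only [map_mul, hw, Complex.conj_conj]
          ring
        · rw [if_neg hs, Finsupp.single_eq_of_ne hs]; simp
      · refine Finset.sum_congr rfl fun s _ => ?_
        by_cases hs : s.1 = m
        · rw [if_pos hs, hs, Finsupp.single_eq_same]
          simp only [map_mul, hw, Complex.conj_conj]
          ring
        · rw [if_neg hs, Finsupp.single_eq_of_ne hs]; simp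

end Potential

/-! ### Functions on the circle supported in an arc -/

/-- The representative of a point of the circle in `[b - π, b + π)`. -/
noncomputable def arcCoord (b : ℝ) (y : S1) : ℝ :=
  (AddCircle.equivIco (2 * Real.pi) (b - Real.pi) y : ℝ)

theorem coe_arcCoord (b : ℝ) (y : S1) : (arcCoord b y : S1) = y := AddCircle.coe_equivIco

theorem arcCoord_coe {b x : ℝ} (h1 : b - Real.pi ≤ x) (h2 : x < b + Real.pi) :
    arcCoord b (x : S1) = x :=
  AddCircle.equivIco_coe_of_mem ⟨h1, by linarith⟩

theorem arcCoord_self (b : ℝ) : arcCoord b (b : S1) = b :=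
  arcCoord_coe (by linarith [Real.pi_pos]) (by linarith [Real.pi_pos])

theorem arcCoord_mem (b : ℝ) (y : S1) :
    b - Real.pi ≤ arcCoord b y ∧ arcCoord b y < b + Real.pi := by
  have h := (AddCircle.equivIco (2 * Real.pi) (b - Real.pi) y).2
  exact ⟨h.1, by have := h.2; unfold arcCoord; linarith⟩

theorem one_lt_pi : (1 : ℝ) < Real.pi := by linarith [Real.pi_gt_three]

theorem isSmooth_comp_arcCoord {b : ℝ} {F : ℝ → ℂ} (hF : ContDiff ℝ ∞ F)
    (h0 : ∀ x, 1 ≤ |x - b| → F x = 0) : IsSmooth (fun y => F (arcCoord b y)) := by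
  have hπ := one_lt_pi
  refine contDiff_iff_contDiffAt.2 fun s => ?_
  set s' := arcCoord b (s : S1) with hs'
  have hmem := arcCoord_mem b (s : S1)
  have hper : ∀ x : ℝ, ((x - (s - s') : ℝ) : S1) = (x : S1) := fun x => by
    have h1 : ((s - s' : ℝ) : S1) = 0 := by rw [AddCircle.coe_sub, hs', coe_arcCoord, sub_self]
    rw [AddCircle.coe_sub, h1, sub_zero]
  -- the coordinate jumps at the antipode `b - π` of `b`, but there the function vanishes
  rcases hmem.1.lt_or_eq with h | h
  · refine (hF.comp (contDiff_id.sub contDiff_const)).contDiffAt.congr_of_eventuallyEq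
      (f := F ∘ fun x => x - (s - s')) ?_
    have h1 : ∀ᶠ x in 𝓝 s, x - (s - s') ∈ Set.Ioo (b - Real.pi) (b + Real.pi) := by
      refine (Continuous.tendsto (by fun_prop) s).eventually (isOpen_Ioo.mem_nhds ?_)
      rw [sub_sub_cancel]
      exact ⟨h, hmem.2⟩
    filter_upwards [h1] with x hx
    rw [Function.comp_apply, ← arcCoord_coe hx.1.le hx.2, hper]
  · refine (contDiffAt_const (c := (0 : ℂ))).congr_of_eventuallyEq ?_
    have h1 : ∀ᶠ x in 𝓝 s, x - (s - s') ∈ Set.Ioo (b - Real.pi - (Real.pi - 1))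
        (b - Real.pi + (Real.pi - 1)) := by
      refine (Continuous.tendsto (by fun_prop) s).eventually (isOpen_Ioo.mem_nhds ?_)
      rw [sub_sub_cancel, hs', ← h]
      exact ⟨by linarith, by linarith⟩
    filter_upwards [h1] with x hx
    apply h0
    rw [← hper]
    rcases le_or_gt (b - Real.pi) (x - (s - s')) with h2 | h2
    · rw [arcCoord_coe h2 (by linarith [hx.2]), abs_of_nonpos] <;> linarith [hx.2]
    · have h3 : ((x - (s - s') : ℝ) : S1) = ((x - (s - s') + 2 * Real.pi : ℝ) : S1) :=
        (AddCircle.coe_add_period _ _).symm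
      rw [h3, arcCoord_coe (by linarith [hx.1]) (by linarith), abs_of_nonneg] <;> linarith [hx.1]

theorem integral_comp_arcCoord {b : ℝ} {F : ℝ → ℂ} (h0 : ∀ x, 1 ≤ |x - b| → F x = 0) :
    ∫ y, F (arcCoord b y) = ∫ x, F x := by
  have hπ := one_lt_pi
  rw [← AddCircle.integral_preimage (2 * Real.pi) (b - Real.pi), integral_Ioc_eq_integral_Ioo,
    ← setIntegral_eq_integral_of_forall_compl_eq_zero
      (s := Set.Ioo (b - Real.pi) (b - Real.pi + 2 * Real.pi)) (f := F)]
  · refine setIntegral_congr_fun measurableSet_Ioo fun x hx => ?_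
    rw [arcCoord_coe hx.1.le (by linarith [hx.2])]
  · intro x hx
    apply h0
    by_contra hcon
    rw [not_le, abs_lt] at hcon
    exact hx ⟨by linarith, by linarith⟩

/-- The weighted composition operator `f ↦ w · (f ∘ e)`, for a weight `w` supported in an arc around
`b`, on which `e` is smooth. -/
noncomputable def weightedComp (b : ℝ) (w : ℝ → ℂ) (e : ℝ → ℝ) (h0 : ∀ x, 1 ≤ |x - b| → w x = 0)
    (hs : ∀ f : ℝ → ℂ, ContDiff ℝ ∞ f → ContDiff ℝ ∞ (fun x => w x * f (e x))) :
    SmoothFn →ₗ[ℂ] SmoothFn where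
  toFun f := ⟨fun y => w (arcCoord b y) * (f : S1 → ℂ) (e (arcCoord b y) : ℝ),
    isSmooth_comp_arcCoord (F := fun x => w x * (f : S1 → ℂ) (e x : ℝ)) (hs _ f.2)
      fun x hx => by rw [h0 x hx, zero_mul]⟩
  map_add' f g := by ext y; simp [mul_add]
  map_smul' c f := by ext y; simp; ring

theorem weightedComp_apply {b : ℝ} {w : ℝ → ℂ} {e : ℝ → ℝ} (h0 : ∀ x, 1 ≤ |x - b| → w x = 0)
    (hs : ∀ f : ℝ → ℂ, ContDiff ℝ ∞ f → ContDiff ℝ ∞ (fun x => w x * f (e x)))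
    (f : SmoothFn) (y : S1) : (weightedComp b w e h0 hs f : S1 → ℂ) y =
      w (arcCoord b y) * (f : S1 → ℂ) (e (arcCoord b y) : ℝ) := rfl

theorem integral_conj_mul_weightedComp {b : ℝ} {w : ℝ → ℂ} {e : ℝ → ℝ}
    (h0 : ∀ x, 1 ≤ |x - b| → w x = 0)
    (hs : ∀ f : ℝ → ℂ, ContDiff ℝ ∞ f → ContDiff ℝ ∞ (fun x => w x * f (e x)))
    (f h : SmoothFn) :
    ∫ y, conj ((h : S1 → ℂ) y) * (weightedComp b w e h0 hs f : S1 → ℂ) y =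
      ∫ x : ℝ, conj ((h : S1 → ℂ) x) * (w x * (f : S1 → ℂ) (e x : ℝ)) := by
  rw [← integral_comp_arcCoord (b := b)
    (F := fun x : ℝ => conj ((h : S1 → ℂ) x) * (w x * (f : S1 → ℂ) (e x : ℝ)))
    fun x hx => by simp [h0 x hx]]
  simp only [weightedComp_apply, coe_arcCoord]

theorem contDiff_bump_mul {b : ℝ} (χ : ContDiffBump b) {F : ℝ → ℂ}
    (hF : ∀ x ∈ Metric.closedBall b χ.rOut, ContDiffAt ℝ ∞ F x) :
    ContDiff ℝ ∞ (fun x => (χ x : ℂ) * F x) := by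
  refine contDiff_iff_contDiffAt.2 fun x => ?_
  by_cases hx : x ∈ Metric.closedBall b χ.rOut
  · exact (Complex.ofRealCLM.contDiff.comp χ.contDiff).contDiffAt.mul (hF x hx)
  · refine (contDiffAt_const (c := (0 : ℂ))).congr_of_eventuallyEq ?_
    filter_upwards [Metric.isClosed_closedBall.isOpen_compl.mem_nhds hx] with z hz
    rw [χ.zero_of_le_dist, Complex.ofReal_zero, zero_mul]
    exact le_of_not_ge hz

/-! ### Local diffeomorphisms between solutions of one sector -/

/-- A partial homeomorphism of the line that is smooth together with its inverse, that is, a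
diffeomorphism between two open sets. -/
structure IsLocalDiffeo (e : OpenPartialHomeomorph ℝ ℝ) : Prop where
  smooth : ∀ x ∈ e.source, ContDiffAt ℝ ∞ e x
  smooth_symm : ∀ t ∈ e.target, ContDiffAt ℝ ∞ e.symm t

theorem IsLocalDiffeo.symm {e : OpenPartialHomeomorph ℝ ℝ} (h : IsLocalDiffeo e) :
    IsLocalDiffeo e.symm :=
  ⟨h.smooth_symm, h.smooth⟩

theorem IsLocalDiffeo.trans {e e' : OpenPartialHomeomorph ℝ ℝ} (h : IsLocalDiffeo e)
    (h' : IsLocalDiffeo e') : IsLocalDiffeo (e.trans e') := by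
  constructor
  · intro x hx
    rw [OpenPartialHomeomorph.trans_source] at hx
    exact (h'.smooth _ hx.2).comp x (h.smooth x hx.1)
  · intro t ht
    rw [OpenPartialHomeomorph.trans_target] at ht
    exact (h.smooth_symm _ ht.2).comp t (h'.smooth_symm t ht.1)

theorem IsLocalDiffeo.deriv_ne_zero {e : OpenPartialHomeomorph ℝ ℝ} (h : IsLocalDiffeo e) {x : ℝ}
    (hx : x ∈ e.source) : deriv e x ≠ 0 := by
  intro h0
  have h1 : HasDerivAt e (deriv e x) x :=
    ((h.smooth x hx).differentiableAt (by simp)).hasDerivAt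
  have h2 : HasDerivAt e.symm (deriv e.symm (e x)) (e x) :=
    ((h.smooth_symm _ (e.map_source hx)).differentiableAt (by simp)).hasDerivAt
  have h3 := h2.comp x h1
  have h4 : HasDerivAt (e.symm ∘ e) 1 x := (hasDerivAt_id x).congr_of_eventuallyEq (by
    filter_upwards [e.open_source.mem_nhds hx] with z hz using e.left_inv hz)
  have := h3.unique h4
  rw [h0, mul_zero] at this
  exact zero_ne_one this

theorem exists_isLocalDiffeo_of_deriv_ne_zero {X : ℝ → ℝ} {V : Set ℝ} (hV : IsOpen V)
    (hX : ContDiffOn ℝ ∞ X V) {a : ℝ} (ha : a ∈ V) (hd : deriv X a ≠ 0) :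
    ∃ e : OpenPartialHomeomorph ℝ ℝ, IsLocalDiffeo e ∧ a ∈ e.source ∧ e.source ⊆ V ∧
      ∀ x, e x = X x := by
  have hXat : ∀ x ∈ V, ContDiffAt ℝ ∞ X x := fun x hx => hX.contDiffAt (hV.mem_nhds hx)
  have hstrict : HasStrictDerivAt X (deriv X a) a :=
    (hXat a ha).hasStrictDerivAt (by simp)
  have hF := hstrict.hasStrictFDerivAt_equiv hd
  have hW : ∀ᶠ x in 𝓝 a, x ∈ V ∧ deriv X x ≠ 0 := by
    refine (hV.eventually_mem ha).and ?_
    have hc : ContinuousAt (deriv X) a :=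
      (hX.continuousOn_deriv_of_isOpen hV (by simp)).continuousAt (hV.mem_nhds ha)
    exact hc.eventually_ne hd
  obtain ⟨W, hWs, hWo, haW⟩ := eventually_nhds_iff.1 hW
  refine ⟨(hF.toOpenPartialHomeomorph X).restrOpen W hWo, ⟨?_, ?_⟩, ?_, ?_, ?_⟩
  · intro x hx
    exact hXat x (hWs x hx.2).1
  · intro t ht
    have hx := OpenPartialHomeomorph.map_target _ ht
    have hx' := hWs _ hx.2
    exact OpenPartialHomeomorph.contDiffAt_symm_deriv _ hx'.2 ht
      (((hXat _ hx'.1).differentiableAt (by simp)).hasDerivAt) (hXat _ hx'.1)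
  · exact ⟨hF.mem_toOpenPartialHomeomorph_source, haW⟩
  · exact fun x hx => (hWs x hx.2).1
  · exact fun x => rfl

namespace Potential

variable {R : Potential}

/-- Near a solution of the sector `σ`, there is a smooth coordinate in which `R - m²` is the
monomial `± xᵖ`, with a sign that depends on the sector only. -/
theorem exists_normal_form {σ : Label} {m : ℤ} {a : ℝ} (hs : (m, (a : S1)) ∈ R.sector σ) :
    ∃ e : OpenPartialHomeomorph ℝ ℝ, IsLocalDiffeo e ∧ a ∈ e.source ∧ e a = 0 ∧
      ∀ x ∈ e.source, R (x : S1) - R (a : S1) = σ.sign * e x ^ σ.p := by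
  obtain ⟨g, hg, hfg, hg0⟩ := R.exists_local_factor a
  have hp : R.order (a : S1) = σ.p := order_eq_of_mem_sector hs
  have hD := (R.order_spec (a : S1)).2
  have hp0 : 0 < σ.p := hp ▸ (R.order_spec (a : S1)).1
  rw [hp] at hfg hg0 hD
  have hfac : (0 : ℝ) < σ.p.factorial := by exact_mod_cast σ.p.factorial_pos
  have hg0' : g 0 ≠ 0 := fun h => hD (by rw [hg0, h, mul_zero])
  -- the sign `c` of the leading coefficient is absorbed in the coordinate if `p` is odd
  obtain ⟨κ, c, hκ, hc2, hcκ, hcg⟩ : ∃ κ c : ℝ, κ ≠ 0 ∧ c * c = 1 ∧ σ.sign * κ ^ σ.p = c ∧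
      0 < c * g 0 := by
    rcases σ with p | ⟨p, ε⟩
    · have hodd : Odd p := hs.2.2
      rcases lt_or_gt_of_ne hg0' with h | h
      · exact ⟨-1, -1, by norm_num, by norm_num, by simp [Label.sign, Label.p, hodd.neg_one_pow],
          by linarith⟩
      · exact ⟨1, 1, by norm_num, by norm_num, by simp [Label.sign], by linarith⟩
    · have h1 : 0 < ((ε : ℤ) : ℝ) * circleDeriv p R (a : S1) := hs.2.2.2
      change circleDeriv p R (a : S1) = p.factorial * g 0 at hg0
      rw [hg0, mul_left_comm] at h1
      refine ⟨1, ((ε : ℤ) : ℝ), one_ne_zero, ?_, by simp [Label.sign],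
        (pos_iff_pos_of_mul_pos h1).1 hfac⟩
      rcases Int.units_eq_one_or ε with h | h <;> simp [h]
  set V : Set ℝ := {x | 0 < c * g (x - a)} with hVdef
  have hV : IsOpen V := isOpen_lt continuous_const
    (continuous_const.mul (hg.continuous.comp (continuous_id.sub continuous_const)))
  have haV : a ∈ V := by simpa [hVdef] using hcg
  set Y : ℝ → ℝ := fun x => (c * g (x - a)) ^ (1 / (σ.p : ℝ)) with hY
  have hYs : ∀ x ∈ V, ContDiffAt ℝ ∞ Y x := fun x hx =>
    ((contDiff_const.mul (hg.comp (contDiff_id.sub contDiff_const))).contDiffAt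
      (f := fun x => c * g (x - a))).rpow_const_of_ne (ne_of_gt hx)
  set X : ℝ → ℝ := fun x => κ * (x - a) * Y x with hX
  have hXs : ContDiffOn ℝ ∞ X V := fun x hx =>
    (((contDiff_const.mul (contDiff_id.sub contDiff_const)).contDiffAt (x := x)).mul
      (hYs x hx)).contDiffWithinAt
  have hd : HasDerivAt X (κ * Y a) a := by
    have h1 : HasDerivAt (fun x => κ * (x - a)) (κ * 1) a :=
      ((hasDerivAt_id a).sub_const a).const_mul κ
    have h2 := h1.mul ((hYs a haV).differentiableAt (by simp)).hasDerivAt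
    refine h2.congr_deriv ?_
    rw [sub_self, mul_zero, zero_mul, add_zero, mul_one]
  have hYa : 0 < Y a := Real.rpow_pos_of_pos haV _
  obtain ⟨e, he, hae, heV, heX⟩ := exists_isLocalDiffeo_of_deriv_ne_zero hV hXs haV
    (by rw [hd.deriv]; exact mul_ne_zero hκ hYa.ne')
  refine ⟨e, he, hae, by rw [heX]; simp [hX], fun x hx => ?_⟩
  have h1 := hfg (x - a)
  rw [add_sub_cancel] at h1
  have h2 : Y x ^ σ.p = c * g (x - a) := by
    rw [hY, one_div, Real.rpow_inv_natCast_pow (heV hx).le hp0.ne']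
  have h3 : X x = κ * (x - a) * Y x := rfl
  rw [h1, heX, h3, mul_pow, mul_pow, h2]
  linear_combination (-(x - a) ^ σ.p * (c * g (x - a))) * hcκ - (x - a) ^ σ.p * g (x - a) * hc2

/-- A local diffeomorphism that carries one solution of a sector to another one and `R - n²` to
`R - m²`. -/
theorem exists_transition {σ : Label} {m n : ℤ} {a b : ℝ} (ha : (m, (a : S1)) ∈ R.sector σ)
    (hb : (n, (b : S1)) ∈ R.sector σ) :
    ∃ e : OpenPartialHomeomorph ℝ ℝ, IsLocalDiffeo e ∧ b ∈ e.source ∧ e b = a ∧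
      ∀ x ∈ e.source, R (e x : S1) - R (a : S1) = R (x : S1) - R (b : S1) := by
  obtain ⟨ea, hea, haa, hea0, hRa⟩ := exists_normal_form ha
  obtain ⟨eb, heb, hbb, heb0, hRb⟩ := exists_normal_form hb
  refine ⟨eb.trans ea.symm, heb.trans hea.symm, ?_, ?_, fun x hx => ?_⟩
  · rw [OpenPartialHomeomorph.trans_source]
    refine ⟨hbb, ?_⟩
    rw [Set.mem_preimage, heb0, ← hea0]
    exact ea.map_source haa
  · rw [OpenPartialHomeomorph.trans_apply, heb0, ← hea0, ea.left_inv haa]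
  · rw [OpenPartialHomeomorph.trans_source] at hx
    rw [OpenPartialHomeomorph.trans_apply, hRa _ (ea.map_target hx.2), ea.right_inv hx.2,
      hRb x hx.1]

end Potential

/-- A bump function at `b` with support in a given neighbourhood, which avoids the points of a finite
set other than `b`. -/
theorem exists_bump_arc {b : ℝ} {U : Set ℝ} (hU : IsOpen U) (hb : b ∈ U) (S : Finset S1) :
    ∃ χ : ContDiffBump b, Metric.closedBall b χ.rOut ⊆ U ∧ (∀ x, 1 ≤ |x - b| → χ x = 0) ∧
      ∀ y ∈ S, y ≠ (b : S1) → χ (arcCoord b y) = 0 := by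
  have h1 : ∀ᶠ r : ℝ in 𝓝[>] 0, Metric.closedBall b r ⊆ U := by
    obtain ⟨r, hr, h⟩ := Metric.nhds_basis_closedBall.mem_iff.1 (hU.mem_nhds hb)
    filter_upwards [(eventually_le_nhds hr).filter_mono nhdsWithin_le_nhds] with ρ hρ
    exact (Metric.closedBall_subset_closedBall hρ).trans h
  have h2 : ∀ᶠ r : ℝ in 𝓝[>] 0, r ≤ 1 :=
    (eventually_le_nhds one_pos).filter_mono nhdsWithin_le_nhds
  have h3 : ∀ᶠ r : ℝ in 𝓝[>] 0, ∀ y ∈ S, y ≠ (b : S1) → r ≤ dist (arcCoord b y) b := by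
    refine (Filter.eventually_all_finset _).2 fun y _ => ?_
    by_cases hy : y = (b : S1)
    · simp [hy]
    · have : 0 < dist (arcCoord b y) b := dist_pos.2 fun h => hy (by rw [← h, coe_arcCoord])
      filter_upwards [(eventually_le_nhds this).filter_mono nhdsWithin_le_nhds] with r hr _
      exact hr
  obtain ⟨r, ⟨⟨h1, h2⟩, h3⟩, hr⟩ := (((h1.and h2).and h3).and self_mem_nhdsWithin).exists
  have hr : 0 < r := hr
  refine ⟨⟨r / 2, r, half_pos hr, half_lt_self hr⟩, h1, fun x hx => ?_, fun y hy hyb => ?_⟩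
  · exact ContDiffBump.zero_of_le_dist _ (by rw [Real.dist_eq]; exact h2.trans hx)
  · exact ContDiffBump.zero_of_le_dist _ (h3 y hy hyb)

theorem ContDiffBump.apply_self {b : ℝ} (χ : ContDiffBump b) : χ b = 1 :=
  χ.one_of_mem_closedBall (Metric.mem_closedBall_self χ.rIn_pos.le)

/-- The constant function `1` on the circle. -/
def oneSmooth : SmoothFn := ⟨fun _ => 1, (contDiff_const : ContDiff ℝ ∞ fun _ : ℝ => (1 : ℂ))⟩

theorem deltaMap_apply_single_right (S : Finset (ℤ × S1)) (c : ℤ × S1 → ℂ)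
    {n : ℤ} {b : S1} (hb : (n, b) ∈ S) (f : TestSpace) (g : SmoothFn)
    (h : ∀ y, (n, y) ∈ S → y ≠ b → (f n : S1 → ℂ) y * (g : S1 → ℂ) y = 0) :
    Potential.deltaMap S c f (Finsupp.single n g) =
      (2 * Real.pi : ℂ) ^ 2 * (c (n, b) * (conj ((f n : S1 → ℂ) b) * (g : S1 → ℂ) b)) := by
  rw [Potential.deltaMap_apply, Finset.sum_eq_single (n, b)]
  · simp [mul_assoc]
  · rintro ⟨k, y⟩ hs hne
    by_cases hk : k = n
    · subst hk
      have := h y hs fun hy => hne (by rw [hy])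
      rcases mul_eq_zero.1 this with h0 | h0 <;> simp [h0]
    · simp [Finsupp.single_eq_of_ne hk]
  · exact fun hnot => absurd hb hnot

theorem deltaMap_apply_single_left (S : Finset (ℤ × S1)) (c : ℤ × S1 → ℂ)
    {m : ℤ} {a : S1} (ha : (m, a) ∈ S) (f : SmoothFn) (g : TestSpace)
    (h : ∀ y, (m, y) ∈ S → y ≠ a → (f : S1 → ℂ) y * (g m : S1 → ℂ) y = 0) :
    Potential.deltaMap S c (Finsupp.single m f) g =
      (2 * Real.pi : ℂ) ^ 2 * (c (m, a) * (conj ((f : S1 → ℂ) a) * (g m : S1 → ℂ) a)) := by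
  rw [Potential.deltaMap_apply, Finset.sum_eq_single (m, a)]
  · simp [mul_assoc]
  · rintro ⟨k, y⟩ hs hne
    by_cases hk : k = m
    · subst hk
      have := h y hs fun hy => hne (by rw [hy])
      rcases mul_eq_zero.1 this with h0 | h0 <;> simp [h0]
    · simp [Finsupp.single_eq_of_ne hk]
  · exact fun hnot => absurd ha hnot

namespace Potential

variable {R : Potential}

/-! ### Observables that connect two solutions of one sector -/

/-- For two solutions of one sector, some observable has a matrix element between them and no
other matrix element: it is a weighted composition with a local diffeomorphism that preserves
`R - m²`. -/
theorem exists_connecting_observable {σ : Label} (S : Finset (ℤ × S1)) {s s' : ℤ × S1}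
    (hs : s ∈ R.sector σ) (hs' : s' ∈ R.sector σ) (hsS : s ∈ S) (hsS' : s' ∈ S) :
    ∃ (O : R.Observable) (φ g : TestSpace) (J : ℂ), ∀ c : ℤ × S1 → ℂ,
      deltaMap S c (O.act φ) g = (2 * Real.pi : ℂ) ^ 2 * c s' ∧
      deltaMap S c φ (O.actAdj g) = (2 * Real.pi : ℂ) ^ 2 * (c s * J) := by
  classical
  obtain ⟨m, a⟩ := s
  obtain ⟨n, b⟩ := s'
  obtain ⟨a, rfl⟩ := QuotientAddGroup.mk_surjective a
  obtain ⟨b, rfl⟩ := QuotientAddGroup.mk_surjective b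
  change ℝ at a b
  change (m, (a : S1)) ∈ R.sector σ at hs
  change (n, (b : S1)) ∈ R.sector σ at hs'
  change (m, (a : S1)) ∈ S at hsS
  change (n, (b : S1)) ∈ S at hsS'
  obtain ⟨e, he, hbe, hba, hR⟩ := exists_transition hs hs'
  have hae : a ∈ e.target := hba ▸ e.map_source hbe
  obtain ⟨χa, hχa, hχa0, hχaS⟩ := exists_bump_arc e.open_target hae (S.image Prod.snd)
  obtain ⟨χb, hχb, hχb0, hχbS⟩ := exists_bump_arc e.open_source hbe (S.image Prod.snd)
  set w : ℝ → ℂ := fun x => (χb x : ℂ) * χa (e x) with hw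
  set w' : ℝ → ℂ := fun y => (χa y : ℂ) * (χb (e.symm y) * |deriv e.symm y| : ℝ) with hw'
  have hw0 : ∀ x, 1 ≤ |x - b| → w x = 0 := fun x hx => by simp [hw, hχb0 x hx]
  have hw0' : ∀ y, 1 ≤ |y - a| → w' y = 0 := fun y hy => by simp [hw', hχa0 y hy]
  have hws : ∀ f : ℝ → ℂ, ContDiff ℝ ∞ f → ContDiff ℝ ∞ (fun x => w x * f (e x)) := by
    intro f hf
    simp only [hw, mul_assoc]
    refine contDiff_bump_mul χb (F := fun x => (χa (e x) : ℂ) * f (e x)) fun x hx => ?_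
    exact ContDiffAt.comp (g := fun z => (χa z : ℂ) * f z) x
      ((Complex.ofRealCLM.contDiff.comp χa.contDiff).mul hf).contDiffAt (he.smooth x (hχb hx))
  have hws' : ∀ f : ℝ → ℂ, ContDiff ℝ ∞ f → ContDiff ℝ ∞ (fun y => w' y * f (e.symm y)) := by
    intro f hf
    simp only [hw', mul_assoc]
    refine contDiff_bump_mul χa
      (F := fun y => ((χb (e.symm y) * |deriv e.symm y| : ℝ) : ℂ) * f (e.symm y)) fun y hy => ?_
    have hy := hχa hy
    have hsm := he.smooth_symm y hy
    have hd : ContDiffAt ℝ ∞ (deriv e.symm) y :=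
      (ContDiffOn.deriv_of_isOpen (n := ∞) (m := ∞)
        (fun t ht => (he.smooth_symm t ht).contDiffWithinAt) e.open_target (by simp)).contDiffAt
        (e.open_target.mem_nhds hy)
    have hd' : ContDiffAt ℝ ∞ (fun y => |deriv e.symm y|) y :=
      (contDiffAt_abs (he.symm.deriv_ne_zero hy)).comp y hd
    exact (Complex.ofRealCLM.contDiff.contDiffAt.comp y
      ((χb.contDiff.contDiffAt.comp y hsm).mul hd')).mul (hf.contDiffAt.comp y hsm)
  let T := weightedComp b w e hw0 hws
  let T' := weightedComp a w' e.symm hw0' hws'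
  -- `T'` is the adjoint of `T` by the change of variables `x = e.symm y`
  have hTT' : ∀ f h : SmoothFn, ∫ y, conj ((h : S1 → ℂ) y) * (T f : S1 → ℂ) y =
      ∫ y, conj ((T' h : S1 → ℂ) y) * (f : S1 → ℂ) y := by
    intro f h
    have h1 : ∫ y, conj ((T' h : S1 → ℂ) y) * (f : S1 → ℂ) y =
        conj (∫ y, conj ((f : S1 → ℂ) y) * (T' h : S1 → ℂ) y) := by
      rw [← integral_conj]
      congr 1
      funext y
      rw [map_mul, Complex.conj_conj, mul_comm]
    have h2 : ∫ x in e.source, conj ((h : S1 → ℂ) x) * (w x * (f : S1 → ℂ) (e x : ℝ)) =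
        ∫ x : ℝ, conj ((h : S1 → ℂ) x) * (w x * (f : S1 → ℂ) (e x : ℝ)) := by
      refine setIntegral_eq_integral_of_forall_compl_eq_zero fun x hx => ?_
      have : χb x = 0 := χb.zero_of_le_dist (not_lt.1 fun h => hx (hχb
        (Metric.ball_subset_closedBall h)))
      simp [hw, this]
    have h3 : ∫ y in e.target, conj (conj ((f : S1 → ℂ) y) * (w' y * (h : S1 → ℂ) (e.symm y : ℝ))) =
        ∫ y : ℝ, conj (conj ((f : S1 → ℂ) y) * (w' y * (h : S1 → ℂ) (e.symm y : ℝ))) := by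
      refine setIntegral_eq_integral_of_forall_compl_eq_zero fun y hy => ?_
      have : χa y = 0 := χa.zero_of_le_dist (not_lt.1 fun h => hy (hχa
        (Metric.ball_subset_closedBall h)))
      simp [hw', this]
    rw [h1, integral_conj_mul_weightedComp, integral_conj_mul_weightedComp, ← integral_conj, ← h2,
      ← h3, ← e.symm_image_target_eq_source,
      integral_image_eq_integral_abs_deriv_smul e.open_target.measurableSet (f' := deriv e.symm)
        (fun y hy => ((he.smooth_symm y hy).differentiableAt
          (by simp)).hasDerivAt.hasDerivWithinAt) e.symm.injOn]
    refine setIntegral_congr_fun e.open_target.measurableSet fun y hy => ?_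
    simp only [hw, hw', e.right_inv hy, Complex.real_smul, map_mul, Complex.conj_conj,
      Complex.conj_ofReal]
    push_cast
    ring
  let A : TestSpace →ₗ[ℂ] TestSpace := Finsupp.lsingle n ∘ₗ T ∘ₗ Finsupp.lapply m
  let B : TestSpace →ₗ[ℂ] TestSpace := Finsupp.lsingle m ∘ₗ T' ∘ₗ Finsupp.lapply n
  have hA : ∀ φ, A φ = Finsupp.single n (T (φ m)) := fun φ => rfl
  have hB : ∀ φ, B φ = Finsupp.single m (T' (φ n)) := fun φ => rfl
  have hRa : R (a : S1) = (m : ℝ) ^ 2 := (R.sector_subset σ hs).symm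
  have hRb : R (b : S1) = (n : ℝ) ^ 2 := (R.sector_subset σ hs').symm
  obtain ⟨O, hOA, hOB⟩ := Observable.exists_of_formalAdjoint (R := R) A B
    (fun φ ψ => by
      rw [hA, hB, inner_toHaux_single_right, inner_toHaux_single, hTT'])
    (fun t φ => by
      rw [hA, hA, U_single]
      congr 1
      ext y
      simp only [T, weightedComp_apply, mulSmooth, LinearMap.coe_mk, AddHom.coe_mk, U_apply]
      by_cases hx : arcCoord b y ∈ e.source
      · have h1 : R.symb m (e (arcCoord b y) : ℝ) = R.symb n y := by
          have h2 := hR _ hx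
          rw [hRa, hRb, coe_arcCoord] at h2
          simp only [symb]
          have h3 : ((R (e (arcCoord b y) : ℝ) - (m : ℝ) ^ 2 : ℝ) : ℂ) =
            ((R y - (n : ℝ) ^ 2 : ℝ) : ℂ) := by rw [h2]
          push_cast at h3
          linear_combination -h3
        rw [h1]
        ring
      · have h0 : χb (arcCoord b y) = 0 := χb.zero_of_le_dist (not_lt.1 fun h => hx (hχb
          (Metric.ball_subset_closedBall h)))
        simp [hw, h0])
  refine ⟨O, Finsupp.single m oneSmooth, Finsupp.single n oneSmooth, w' a, fun c => ⟨?_, ?_⟩⟩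
  · rw [hOA, hA, Finsupp.single_eq_same, deltaMap_apply_single_right S c hsS']
    · rw [Finsupp.single_eq_same]
      simp only [T, weightedComp_apply, arcCoord_self, hw, hba, ContDiffBump.apply_self,
        oneSmooth]
      simp
    · intro y hy hyb
      rw [Finsupp.single_eq_same]
      simp only [T, weightedComp_apply, hw,
        hχbS y (Finset.mem_image.2 ⟨(n, y), hy, rfl⟩) hyb]
      simp
  · rw [hOB, hB, Finsupp.single_eq_same, deltaMap_apply_single_left S c hsS]
    · rw [Finsupp.single_eq_same]
      simp only [T', weightedComp_apply, arcCoord_self, oneSmooth]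
      simp
    · intro y hy hya
      rw [Finsupp.single_eq_same]
      simp only [T', weightedComp_apply, hw',
        hχaS y (Finset.mem_image.2 ⟨(m, y), hy, rfl⟩) hya]
      simp


theorem conj_weight (σ : Label) (s : ℤ × S1) : conj (R.weight σ s) = R.weight σ s :=
  Complex.conj_ofReal _

theorem weight_re_pos {σ : Label} {s : ℤ × S1} (hs : s ∈ R.sector σ) :
    0 < (R.weight σ s).re := by
  have hD : circleDeriv σ.p R s.2 ≠ 0 := order_eq_of_mem_sector hs ▸ (R.order_spec s.2).2
  rw [weight, Complex.ofReal_re]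
  positivity

theorem weight_ne_zero {σ : Label} {s : ℤ × S1} (hs : s ∈ R.sector σ) : R.weight σ s ≠ 0 :=
  fun h => (weight_re_pos hs).ne' (by rw [h, Complex.zero_re])

/-- Intertwining fixes the coefficients of a sector up to an overall constant. -/
theorem intertwines_deltaMap_iff (hF : R.FactorCondition) {σ : Label} (hσ : σ ∈ R.labels)
    (c : ℤ × S1 → ℂ) : R.Intertwines (deltaMap (R.finite_sector σ).toFinset c) ↔
      ∃ lam : ℂ, ∀ s ∈ R.sector σ, c s = lam * R.weight σ s := by
  have hη := intertwines_etaSector hF hσ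
  constructor
  · intro hc
    obtain ⟨s, hs⟩ := hσ
    refine ⟨c s / R.weight σ s, fun s' hs' => ?_⟩
    obtain ⟨O, φ, g, J, h⟩ := exists_connecting_observable (R.finite_sector σ).toFinset hs hs'
      (by simpa using hs) (by simpa using hs')
    -- `J` depends on the observable only, so that `c` and the weights transform alike
    have key : ∀ c : ℤ × S1 → ℂ, R.Intertwines (deltaMap (R.finite_sector σ).toFinset c) →
        c s' = c s * J := by
      intro c hc
      have h1 : deltaMap (R.finite_sector σ).toFinset c (O.act φ) g =
          deltaMap (R.finite_sector σ).toFinset c φ (O.actAdj g) := by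
        rw [hc O φ]; rfl
      rw [(h c).1, (h c).2] at h1
      refine mul_left_cancel₀ ?_ h1
      have : (2 * Real.pi : ℂ) ≠ 0 := by exact_mod_cast Real.two_pi_pos.ne'
      exact pow_ne_zero 2 this
    have h1 := key c hc
    have h2 := key _ hη
    have h3 := weight_ne_zero hs
    rw [h1, h2]
    field_simp
  · rintro ⟨lam, h⟩ O φ
    have heq : ∀ φ, deltaMap (R.finite_sector σ).toFinset c φ = lam • R.etaSector σ φ := by
      intro φ
      refine LinearMap.ext fun g => ?_
      rw [LinearMap.smul_apply, etaSector, deltaMap_apply, deltaMap_apply, smul_eq_mul,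
        mul_left_comm, Finset.mul_sum _ _ lam]
      congr 1
      refine Finset.sum_congr rfl fun s hs => ?_
      rw [h s (by simpa using hs)]
      ring
    rw [heq, heq, hη O φ, map_smul]

end Potential

/-! ### Interpolation by test functions -/

/-- Test functions take arbitrary values at finitely many pairs `(m, y)`: each mode is a Lagrange
interpolation polynomial in `e^{iy}`. -/
theorem exists_testSpace_interpolation (S : Finset (ℤ × S1)) (d : ℤ × S1 → ℂ) :
    ∃ φ : TestSpace, ∀ s ∈ S, (φ s.1 : S1 → ℂ) s.2 = d s := by
  classical
  let P : ℤ → ℂ[X] := fun m =>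
    Lagrange.interpolate (S.image Prod.snd) (fun y : S1 => (fourier 1 y : ℂ)) fun y => d (m, y)
  have hinj : Set.InjOn (fun y : S1 => (fourier 1 y : ℂ)) (S.image Prod.snd) := by
    intro y _ z _ h
    simp only [fourier_one] at h
    exact AddCircle.injective_toCircle Real.two_pi_pos.ne' (Subtype.ext h)
  have hsm : ∀ m, IsSmooth (fun y : S1 => (P m).eval (fourier 1 y : ℂ)) := fun m => by
    have h := (Polynomial.contDiff_aeval (𝕜 := ℂ) (P m) ∞).restrict_scalars ℝ
    simp only [coe_aeval_eq_eval] at h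
    exact h.comp (isSmooth_fourier 1)
  let k : ℤ → SmoothFn := fun m => ⟨fun y => (P m).eval (fourier 1 y : ℂ), hsm m⟩
  refine ⟨Finsupp.indicator (S.image Prod.fst) fun m _ => k m, fun s hs => ?_⟩
  rw [Finsupp.indicator_of_mem (Finset.mem_image_of_mem _ hs)]
  exact Lagrange.eval_interpolate_at_node _ hinj (Finset.mem_image_of_mem _ hs)

theorem linearIndependent_deltaMode :
    LinearIndependent ℂ (fun s : ℤ × S1 => deltaMode s.1 s.2) := by
  classical
  rw [linearIndependent_iff']
  intro S g h s hs
  obtain ⟨φ, hφ⟩ := exists_testSpace_interpolation S (Pi.single s 1)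
  have h1 := congrArg (fun u : Module.Dual ℂ TestSpace => u φ) h
  simp only [LinearMap.sum_apply, LinearMap.smul_apply, deltaMode_apply, smul_eq_mul,
    LinearMap.zero_apply] at h1
  rw [Finset.sum_eq_single_of_mem s hs fun t ht hts => by rw [hφ t ht]; simp [hts],
    hφ s hs, Pi.single_eq_same, mul_one] at h1
  have : (2 * Real.pi : ℂ) ≠ 0 := by exact_mod_cast Real.two_pi_pos.ne'
  exact (mul_eq_zero.1 h1).resolve_right this

namespace Potential

/-! ### Maps concentrated on finitely many points -/

section DeltaMap

variable {S : Finset (ℤ × S1)} {c : ℤ × S1 → ℂ}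

theorem deltaMap_congr {φ φ' : TestSpace}
    (h : ∀ s ∈ S, (φ s.1 : S1 → ℂ) s.2 = (φ' s.1 : S1 → ℂ) s.2) :
    deltaMap S c φ = deltaMap S c φ' := by
  refine LinearMap.ext fun g => ?_
  rw [deltaMap_apply, deltaMap_apply]
  congr 1
  exact Finset.sum_congr rfl fun s hs => by rw [h s hs]

theorem deltaMap_apply_eq_zero {φ g : TestSpace} (h : ∀ s ∈ S, (g s.1 : S1 → ℂ) s.2 = 0) :
    deltaMap S c φ g = 0 := by
  rw [deltaMap_apply, Finset.sum_eq_zero fun s hs => by rw [h s hs, mul_zero], mul_zero]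

theorem conj_deltaMap (hc : ∀ s ∈ S, conj (c s) = c s) (φ₁ φ₂ : TestSpace) :
    conj (deltaMap S c φ₁ φ₂) = deltaMap S c φ₂ φ₁ := by
  rw [deltaMap_apply, deltaMap_apply, map_mul, map_sum, map_pow, map_mul, Complex.conj_ofReal,
    Complex.conj_ofNat]
  congr 1
  refine Finset.sum_congr rfl fun s hs => ?_
  rw [map_mul, map_mul, hc s hs, Complex.conj_conj]
  ring

theorem deltaMap_self_re (hc : ∀ s ∈ S, conj (c s) = c s) (φ : TestSpace) :
    (deltaMap S c φ φ).re = (2 * Real.pi) ^ 2 *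
      ∑ s ∈ S, (c s).re * Complex.normSq ((φ s.1 : S1 → ℂ) s.2) := by
  have h : deltaMap S c φ φ = (((2 * Real.pi) ^ 2 *
      ∑ s ∈ S, (c s).re * Complex.normSq ((φ s.1 : S1 → ℂ) s.2) : ℝ) : ℂ) := by
    rw [deltaMap_apply]
    push_cast
    congr 1
    refine Finset.sum_congr rfl fun s hs => ?_
    rw [mul_assoc, ← Complex.normSq_eq_conj_mul_self, Complex.conj_eq_iff_re.1 (hc s hs)]
  rw [h, Complex.ofReal_re]

theorem deltaMap_self_nonneg (hc : ∀ s ∈ S, conj (c s) = c s) (hpos : ∀ s ∈ S, 0 < (c s).re)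
    (φ : TestSpace) : 0 ≤ (deltaMap S c φ φ).re := by
  rw [deltaMap_self_re hc]
  exact mul_nonneg (by positivity) (Finset.sum_nonneg fun s hs =>
    mul_nonneg (hpos s hs).le (Complex.normSq_nonneg _))

theorem deltaMap_eq_zero_of_self (hc : ∀ s ∈ S, conj (c s) = c s) (hpos : ∀ s ∈ S, 0 < (c s).re)
    {φ : TestSpace} (h : (deltaMap S c φ φ).re = 0) : deltaMap S c φ = 0 := by
  rw [deltaMap_self_re hc, mul_eq_zero, Finset.sum_eq_zero_iff_of_nonneg fun s hs =>
    mul_nonneg (hpos s hs).le (Complex.normSq_nonneg _)] at h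
  have h1 := h.resolve_left (by positivity)
  rw [deltaMap_congr (φ' := 0), map_zero]
  intro s hs
  simpa [(hpos s hs).ne'] using h1 s hs

theorem range_deltaMap (hne : ∀ s ∈ S, c s ≠ 0) :
    LinearMap.range (deltaMap S c) =
      Submodule.span ℂ ((fun s : ℤ × S1 => deltaMode s.1 s.2) '' S) := by
  classical
  apply le_antisymm
  · rintro _ ⟨φ, rfl⟩
    refine Submodule.smul_mem _ _ (Submodule.sum_mem _ fun s hs => Submodule.smul_mem _ _ ?_)
    exact Submodule.subset_span ⟨s, hs, rfl⟩
  · rw [Submodule.span_le]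
    rintro _ ⟨s, hs, rfl⟩
    obtain ⟨φ, hφ⟩ := exists_testSpace_interpolation S
      (Pi.single s (conj ((2 * Real.pi * c s : ℂ)⁻¹)))
    refine ⟨φ, LinearMap.ext fun g => ?_⟩
    have h2 : (2 * Real.pi : ℂ) ≠ 0 := by exact_mod_cast Real.two_pi_pos.ne'
    have h3 := hne s hs
    rw [deltaMap_apply, deltaMode_apply, Finset.sum_eq_single_of_mem s hs fun t ht hts => by
      rw [hφ t ht]; simp [hts], hφ s hs, Pi.single_eq_same, Complex.conj_conj]
    field_simp

end DeltaMap

variable {R : Potential}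

theorem deltaMap_invariant {S : Finset (ℤ × S1)} (hS : ∀ s ∈ S, s ∈ R.solutions)
    (c : ℤ × S1 → ℂ) (t : ℝ) (φ : TestSpace) :
    (R.U (-t)).dualMap (deltaMap S c φ) = deltaMap S c φ := by
  refine LinearMap.ext fun g => ?_
  rw [LinearMap.dualMap_apply, deltaMap_apply, deltaMap_apply]
  congr 1
  refine Finset.sum_congr rfl fun s hs => ?_
  have h : (s.1 : ℝ) ^ 2 = R s.2 := hS s hs
  have h0 : R.symb s.1 s.2 = 0 := by
    simp only [symb]
    rw [← h]
    push_cast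
    ring
  rw [U_apply, h0, mul_zero, Complex.exp_zero, one_mul]

/-! ### The RAQ inner product -/

theorem raqInner_self_pos {η : AntiMap} (hη : R.IsRiggingMap η)
    (hdef : ∀ φ, (η φ φ).re = 0 → η φ = 0) {u : Module.Dual ℂ TestSpace} (hu : u ∈ image η)
    (hu0 : u ≠ 0) : 0 < (raqInner η u u).re := by
  obtain ⟨φ, rfl⟩ := hu
  rw [raqInner_apply η hη.real]
  exact lt_of_le_of_ne (hη.positive φ) fun h => hu0 (hdef φ h.symm)

/-! ### The sectors -/

theorem isRiggingMap_etaSector (hF : R.FactorCondition) {σ : Label} (hσ : σ ∈ R.labels) :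
    R.IsRiggingMap (R.etaSector σ) where
  real := conj_deltaMap fun s _ => conj_weight σ s
  positive := deltaMap_self_nonneg (fun s _ => conj_weight σ s)
    fun _ hs => weight_re_pos ((R.finite_sector σ).mem_toFinset.1 hs)
  invariant := deltaMap_invariant
    (fun _ hs => R.sector_subset σ ((R.finite_sector σ).mem_toFinset.1 hs)) _
  intertwines := intertwines_etaSector hF hσ

theorem etaSector_eq_zero_of_self {σ : Label} {φ : TestSpace}
    (h : (R.etaSector σ φ φ).re = 0) : R.etaSector σ φ = 0 :=
  deltaMap_eq_zero_of_self (fun s _ => conj_weight σ s)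
    (fun _ hs => weight_re_pos ((R.finite_sector σ).mem_toFinset.1 hs)) h

theorem image_etaSector (σ : Label) : image (R.etaSector σ) =
    Submodule.span ℂ ((fun s : ℤ × S1 => deltaMode s.1 s.2) '' R.sector σ) := by
  have h := range_deltaMap (S := (R.finite_sector σ).toFinset) (c := R.weight σ)
    fun s hs => weight_ne_zero ((R.finite_sector σ).mem_toFinset.1 hs)
  rwa [Set.Finite.coe_toFinset] at h

theorem finiteDimensional_image_etaSector (σ : Label) :
    FiniteDimensional ℂ (image (R.etaSector σ)) := by
  rw [image_etaSector]
  exact FiniteDimensional.span_of_finite ℂ ((R.finite_sector σ).image _)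

theorem image_etaSector_ne_bot {σ : Label} (hσ : σ ∈ R.labels) : image (R.etaSector σ) ≠ ⊥ := by
  obtain ⟨s, hs⟩ := hσ
  rw [image_etaSector, Submodule.ne_bot_iff]
  exact ⟨_, Submodule.subset_span ⟨s, hs, rfl⟩, linearIndependent_deltaMode.ne_zero s⟩

theorem eq_of_mem_sector {σ τ : Label} {s : ℤ × S1} (hσ : s ∈ R.sector σ) (hτ : s ∈ R.sector τ) :
    σ = τ := by
  have hp : σ.p = τ.p := (order_eq_of_mem_sector hσ).symm.trans (order_eq_of_mem_sector hτ)
  rcases σ with p | ⟨p, ε⟩ <;> rcases τ with p' | ⟨p', ε'⟩ <;>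
    simp only [Label.p] at hp <;> subst hp
  · rfl
  · exact absurd hτ.2.2.1 (Nat.not_even_iff_odd.2 hσ.2.2)
  · exact absurd hσ.2.2.1 (Nat.not_even_iff_odd.2 hτ.2.2)
  · have h1 := hσ.2.2.2
    have h2 := hτ.2.2.2
    rcases Int.units_eq_one_or ε with rfl | rfl <;> rcases Int.units_eq_one_or ε' with rfl | rfl
    · rfl
    · norm_num at h1 h2
      linarith
    · norm_num at h1 h2
      linarith
    · rfl

/-- Vectors in the image of a sector map are images of test functions that vanish at the solutions
outside the sector, and on which all other sector maps therefore vanish. -/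
theorem exists_lift_vanishing_off_sector {σ : Label} {u : Module.Dual ℂ TestSpace}
    (hu : u ∈ image (R.etaSector σ)) : ∃ φ : TestSpace, R.etaSector σ φ = u ∧
      ∀ τ, τ ≠ σ → ∀ s ∈ R.sector τ, (φ s.1 : S1 → ℂ) s.2 = 0 := by
  classical
  obtain ⟨φ₀, rfl⟩ := hu
  obtain ⟨φ, hφ⟩ := exists_testSpace_interpolation R.finite_solutions.toFinset
    fun s => if s ∈ R.sector σ then (φ₀ s.1 : S1 → ℂ) s.2 else 0
  refine ⟨φ, deltaMap_congr fun s hs => ?_, fun τ hτ s hs => ?_⟩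
  · have hs := (R.finite_sector σ).mem_toFinset.1 hs
    rw [hφ s (R.finite_solutions.mem_toFinset.2 (R.sector_subset σ hs)), if_pos hs]
  · rw [hφ s (R.finite_solutions.mem_toFinset.2 (R.sector_subset τ hs)),
      if_neg fun h => hτ (eq_of_mem_sector hs h)]

theorem iSupIndep_image : iSupIndep (fun σ : R.labels => image (R.etaSector σ)) := by
  intro σ
  simp only [image_etaSector]
  have h : Disjoint (R.sector σ) (⋃ τ : R.labels, ⋃ _ : τ ≠ σ, R.sector τ) := by
    rw [Set.disjoint_left]
    intro s hs hs'
    simp only [Set.mem_iUnion] at hs'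
    obtain ⟨τ, hτ, hs'⟩ := hs'
    exact hτ (Subtype.ext (eq_of_mem_sector hs' hs))
  refine (linearIndependent_deltaMode.disjoint_span_image h).mono_right ?_
  exact iSup₂_le fun τ hτ => Submodule.span_mono (Set.image_mono
    (Set.subset_iUnion₂ (s := fun (τ : R.labels) (_ : τ ≠ σ) => R.sector τ) τ hτ))

theorem image_inf_image {σ τ : Label} (h : σ ≠ τ) :
    image (R.etaSector σ) ⊓ image (R.etaSector τ) = ⊥ := by
  rw [image_etaSector, image_etaSector]
  exact (linearIndependent_deltaMode.disjoint_span_image (Set.disjoint_left.2 fun s hs hs' =>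
    h (eq_of_mem_sector hs hs'))).eq_bot

/-! ### The total map -/

theorem etaTot_apply (φ : TestSpace) :
    R.etaTot φ = ∑ σ ∈ R.finite_labels.toFinset, R.etaSector σ φ := by
  rw [etaTot, LinearMap.sum_apply]

theorem etaTot_apply_apply (φ g : TestSpace) :
    R.etaTot φ g = ∑ σ ∈ R.finite_labels.toFinset, R.etaSector σ φ g := by
  rw [etaTot_apply, LinearMap.sum_apply]

theorem isRiggingMap_etaTot (hF : R.FactorCondition) : R.IsRiggingMap R.etaTot := by
  have h : ∀ σ ∈ R.finite_labels.toFinset, R.IsRiggingMap (R.etaSector σ) := fun σ hσ =>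
    isRiggingMap_etaSector hF (R.finite_labels.mem_toFinset.1 hσ)
  constructor
  · intro φ₁ φ₂
    rw [etaTot_apply_apply, etaTot_apply_apply, map_sum]
    exact Finset.sum_congr rfl fun σ hσ => (h σ hσ).real _ _
  · intro φ
    rw [etaTot_apply_apply, Complex.re_sum]
    exact Finset.sum_nonneg fun σ hσ => (h σ hσ).positive φ
  · intro t φ
    rw [etaTot_apply, map_sum]
    exact Finset.sum_congr rfl fun σ hσ => (h σ hσ).invariant t φ
  · intro O φ
    rw [etaTot_apply, etaTot_apply, map_sum]
    exact Finset.sum_congr rfl fun σ hσ => (h σ hσ).intertwines O φ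

theorem etaTot_eq_zero_of_self (hF : R.FactorCondition) {φ : TestSpace}
    (h : (R.etaTot φ φ).re = 0) : R.etaTot φ = 0 := by
  rw [etaTot_apply_apply, Complex.re_sum, Finset.sum_eq_zero_iff_of_nonneg fun σ hσ =>
    (isRiggingMap_etaSector hF (R.finite_labels.mem_toFinset.1 hσ)).positive φ] at h
  rw [etaTot_apply]
  exact Finset.sum_eq_zero fun σ hσ => etaSector_eq_zero_of_self (h σ hσ)

theorem exists_lift_etaTot {σ : Label} (hσ : σ ∈ R.labels) {u : Module.Dual ℂ TestSpace}
    (hu : u ∈ image (R.etaSector σ)) : ∃ φ : TestSpace, R.etaSector σ φ = u ∧ R.etaTot φ = u ∧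
      ∀ τ, τ ≠ σ → ∀ s ∈ R.sector τ, (φ s.1 : S1 → ℂ) s.2 = 0 := by
  obtain ⟨φ, hφ, h⟩ := exists_lift_vanishing_off_sector hu
  refine ⟨φ, hφ, ?_, h⟩
  rw [etaTot_apply, Finset.sum_eq_single_of_mem σ (R.finite_labels.mem_toFinset.2 hσ), hφ]
  intro τ _ hτ
  have h0 : R.etaSector τ φ = R.etaSector τ 0 := deltaMap_congr fun s hs => by
    rw [h τ hτ s ((R.finite_sector τ).mem_toFinset.1 hs)]; rfl
  rw [h0, map_zero]

theorem image_etaTot : image R.etaTot = ⨆ σ ∈ R.labels, image (R.etaSector σ) := by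
  apply le_antisymm
  · rintro _ ⟨φ, rfl⟩
    rw [etaTot_apply]
    exact Submodule.sum_mem _ fun σ hσ => Submodule.mem_iSup_of_mem σ
      (Submodule.mem_iSup_of_mem (R.finite_labels.mem_toFinset.1 hσ) ⟨φ, rfl⟩)
  · refine iSup₂_le fun σ hσ u hu => ?_
    obtain ⟨φ, -, h, -⟩ := exists_lift_etaTot hσ hu
    exact ⟨φ, h⟩

theorem raqInner_etaTot_of_mem (hF : R.FactorCondition) {σ : Label} (hσ : σ ∈ R.labels)
    {u v : Module.Dual ℂ TestSpace} (hu : u ∈ image (R.etaSector σ))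
    (hv : v ∈ image (R.etaSector σ)) :
    raqInner R.etaTot u v = raqInner (R.etaSector σ) u v := by
  obtain ⟨φ, hφ, hφ', -⟩ := exists_lift_etaTot hσ hu
  obtain ⟨ψ, hψ, hψ', -⟩ := exists_lift_etaTot hσ hv
  have h1 := raqInner_apply R.etaTot (isRiggingMap_etaTot hF).real φ ψ
  have h2 := raqInner_apply (R.etaSector σ) (isRiggingMap_etaSector hF hσ).real φ ψ
  rw [hφ', hψ'] at h1
  rw [hφ, hψ] at h2
  rw [h1, h2]

theorem raqInner_etaTot_eq_zero (hF : R.FactorCondition) {σ τ : Label} (hσ : σ ∈ R.labels)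
    (hτ : τ ∈ R.labels) (hne : σ ≠ τ) {u v : Module.Dual ℂ TestSpace}
    (hu : u ∈ image (R.etaSector σ)) (hv : v ∈ image (R.etaSector τ)) :
    raqInner R.etaTot u v = 0 := by
  obtain ⟨φ, -, hφ, hφ0⟩ := exists_lift_etaTot hσ hu
  obtain ⟨ψ, hψ, hψ', -⟩ := exists_lift_etaTot hτ hv
  have h1 := raqInner_apply R.etaTot (isRiggingMap_etaTot hF).real φ ψ
  rw [hφ, hψ'] at h1
  rw [h1, ← hψ]
  exact deltaMap_apply_eq_zero fun s hs =>
    hφ0 τ hne.symm s ((R.finite_sector τ).mem_toFinset.1 hs)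

theorem dualAct_mem_image (hF : R.FactorCondition) {σ : Label} (hσ : σ ∈ R.labels)
    (O : R.Observable) {u : Module.Dual ℂ TestSpace} (hu : u ∈ image (R.etaSector σ)) :
    O.dualAct u ∈ image (R.etaSector σ) := by
  obtain ⟨φ, rfl⟩ := hu
  exact ⟨O.act φ, intertwines_etaSector hF hσ O φ⟩

/-! ### Generic potentials -/

theorem order_eq_one {y : S1} (h : circleDeriv 1 R y ≠ 0) : R.order y = 1 :=
  le_antisymm (Nat.sInf_le ⟨le_rfl, h⟩) (R.order_spec y).1

theorem IsGeneric.order_eq (hG : R.IsGeneric) {s : ℤ × S1} (hs : s ∈ R.solutions) :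
    R.order s.2 = 1 := by
  have h : (s.1 : ℝ) ^ 2 = R s.2 := hs
  refine order_eq_one (hG s.1.natAbs s.2 ?_)
  rw [← h, ← sq_abs (s.1 : ℝ), ← Int.cast_abs, Int.abs_eq_natAbs]
  simp

theorem exists_mem_solutions (hsol : ∃ (q : ℕ) (y : S1), (q : ℝ) ^ 2 = R y) :
    ∃ s, s ∈ R.solutions := by
  obtain ⟨q, y, h⟩ := hsol
  refine ⟨((q : ℤ), y), ?_⟩
  change (((q : ℤ) : ℝ)) ^ 2 = R y
  rw [← h, Int.cast_natCast]

theorem IsGeneric.degrees_eq (hG : R.IsGeneric)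
    (hsol : ∃ (q : ℕ) (y : S1), (q : ℝ) ^ 2 = R y) : R.degrees = {1} := by
  refine Set.eq_singleton_iff_unique_mem.2 ⟨?_, ?_⟩
  · obtain ⟨q, y, h⟩ := hsol
    exact ⟨q, y, h, order_eq_one (hG q y h)⟩
  · rintro p ⟨q, y, h, rfl⟩
    exact order_eq_one (hG q y h)

theorem IsGeneric.sector_eq (hG : R.IsGeneric) : R.sector (.odd 1) = R.solutions :=
  (R.sector_subset _).antisymm fun _ hs => ⟨hs, hG.order_eq hs, odd_one⟩

theorem IsGeneric.labels_eq (hG : R.IsGeneric)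
    (hsol : ∃ (q : ℕ) (y : S1), (q : ℝ) ^ 2 = R y) : R.labels = {.odd 1} := by
  refine Set.eq_singleton_iff_unique_mem.2 ⟨?_, ?_⟩
  · change (R.sector (.odd 1)).Nonempty
    rw [hG.sector_eq]
    exact exists_mem_solutions hsol
  · rintro σ ⟨s, hs⟩
    have h : s ∈ R.sector (.odd 1) := hG.sector_eq ▸ R.sector_subset σ hs
    exact eq_of_mem_sector hs h

theorem IsGeneric.factorCondition (hG : R.IsGeneric)
    (hsol : ∃ (q : ℕ) (y : S1), (q : ℝ) ^ 2 = R y) : R.FactorCondition := by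
  intro p hp d hd _
  rw [hG.degrees_eq hsol, Set.mem_singleton_iff] at hp hd
  rw [hp, hd]
  norm_num

theorem weight_odd_one : R.weight (.odd 1) = R.genericWeight := by
  funext s
  simp [weight, genericWeight, Label.p]

theorem IsGeneric.etaSector_eq (hG : R.IsGeneric) : R.etaSector (.odd 1) = R.eta := by
  have h : (R.finite_sector (.odd 1)).toFinset = R.finite_solutions.toFinset :=
    Set.Finite.toFinset_inj.2 hG.sector_eq
  rw [etaSector, eta, weight_odd_one, h]

end Potential

end Boulware

theorem mainTheorem1 (R : Boulware.Potential)
    (hsol : ∃ (q : ℕ) (y : Boulware.S1), (q : ℝ) ^ 2 = R.toFun y) :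
    -- no solution is a stationary point
    (R.IsGeneric →
      R.degrees = {1} ∧
      R.labels = {Label.odd 1} ∧
      R.etaSector (Label.odd 1) = R.eta ∧
      R.IsRiggingMap R.eta ∧
      FiniteDimensional ℂ (image R.eta) ∧
      image R.eta ≠ ⊥ ∧
      (∀ u ∈ image R.eta, u ≠ 0 → 0 < (raqInner R.eta u u).re) ∧
      (∀ c : ℤ × S1 → ℂ,
        R.Intertwines (deltaMap R.finite_solutions.toFinset c) ↔
          ∃ lam : ℂ, ∀ s ∈ R.solutions, c s = lam * R.genericWeight s)) ∧
    -- stationary points among the solutions are allowed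
    (R.FactorCondition →
      -- each map is a rigging map, with coefficients fixed by intertwining
      (∀ σ ∈ R.labels,
        R.IsRiggingMap (R.etaSector σ) ∧
        FiniteDimensional ℂ (image (R.etaSector σ)) ∧
        image (R.etaSector σ) ≠ ⊥ ∧
        (∀ u ∈ image (R.etaSector σ), u ≠ 0 → 0 < (raqInner (R.etaSector σ) u u).re) ∧
        (∀ c : ℤ × S1 → ℂ,
          R.Intertwines (deltaMap (R.finite_sector σ).toFinset c) ↔
            ∃ lam : ℂ, ∀ s ∈ R.sector σ, c s = lam * R.weight σ s)) ∧
      -- the images of distinct maps meet only in zero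
      (∀ σ ∈ R.labels, ∀ τ ∈ R.labels, σ ≠ τ →
        image (R.etaSector σ) ⊓ image (R.etaSector τ) = ⊥) ∧
      -- superselection: the total space is the direct sum of the images, which are invariant
      -- under the observables, and no observable has matrix elements between distinct images
      iSupIndep (fun σ : R.labels => image (R.etaSector σ)) ∧
      R.IsRiggingMap R.etaTot ∧
      image R.etaTot = (⨆ σ ∈ R.labels, image (R.etaSector σ)) ∧
      (∀ u ∈ image R.etaTot, u ≠ 0 → 0 < (raqInner R.etaTot u u).re) ∧
      (∀ σ ∈ R.labels, ∀ O : R.Observable, ∀ u ∈ image (R.etaSector σ),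
        O.dualAct u ∈ image (R.etaSector σ)) ∧
      (∀ σ ∈ R.labels, ∀ u ∈ image (R.etaSector σ), ∀ v ∈ image (R.etaSector σ),
        raqInner R.etaTot u v = raqInner (R.etaSector σ) u v) ∧
      (∀ σ ∈ R.labels, ∀ τ ∈ R.labels, σ ≠ τ →
        ∀ u ∈ image (R.etaSector σ), ∀ v ∈ image (R.etaSector τ),
          raqInner R.etaTot u v = 0 ∧
          ∀ O : R.Observable, raqInner R.etaTot u (O.dualAct v) = 0)) := by
  refine ⟨fun hG => ?_, fun hF => ?_⟩
  · have hF := hG.factorCondition hsol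
    have hσ : Label.odd 1 ∈ R.labels := by rw [hG.labels_eq hsol]; rfl
    have hR := isRiggingMap_etaSector hF hσ
    have hpos : ∀ u ∈ image (R.etaSector (.odd 1)), u ≠ 0 →
        0 < (raqInner (R.etaSector (.odd 1)) u u).re :=
      fun u hu h0 => raqInner_self_pos hR (fun _ => etaSector_eq_zero_of_self) hu h0
    have hfin := finiteDimensional_image_etaSector (R := R) (.odd 1)
    have hbot := image_etaSector_ne_bot hσ
    have hiff := intertwines_deltaMap_iff hF hσ
    have hS : (R.finite_sector (.odd 1)).toFinset = R.finite_solutions.toFinset :=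
      Set.Finite.toFinset_inj.2 hG.sector_eq
    rw [hS, hG.sector_eq, weight_odd_one] at hiff
    rw [hG.etaSector_eq] at hR hpos hfin hbot
    exact ⟨hG.degrees_eq hsol, hG.labels_eq hsol, hG.etaSector_eq, hR, hfin, hbot, hpos, hiff⟩
  · have hR := isRiggingMap_etaTot hF
    refine ⟨fun σ hσ => ⟨isRiggingMap_etaSector hF hσ, finiteDimensional_image_etaSector σ,
        image_etaSector_ne_bot hσ, fun u hu h0 => raqInner_self_pos (isRiggingMap_etaSector hF hσ)
          (fun _ => etaSector_eq_zero_of_self) hu h0, intertwines_deltaMap_iff hF hσ⟩,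
      fun σ _ τ _ h => image_inf_image h, iSupIndep_image, hR, image_etaTot,
      fun u hu h0 => raqInner_self_pos hR (fun _ => etaTot_eq_zero_of_self hF) hu h0,
      fun σ hσ O u hu => dualAct_mem_image hF hσ O hu,
      fun σ hσ u hu v hv => raqInner_etaTot_of_mem hF hσ hu hv,
      fun σ hσ τ hτ h u hu v hv => ⟨raqInner_etaTot_eq_zero hF hσ hτ h hu hv, fun O =>
        raqInner_etaTot_eq_zero hF hσ hτ h hu (dualAct_mem_image hF hτ O hv)⟩⟩
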